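/- **Theorem 3.2.** *Setting.* A Fibonacci word is a finite word in the letters $1,2$ (possibly the empty word $\varnothing$); its rank $|v|$ is the sum of its digits, and $\mathbb{YF}$ is the set of all Fibonacci words. Write $v\nearrow w$ if $w$ is obtained from $v$ by one of the following operations: (i) put a $1$ at the left end; (ii) replace the leftmost $1$ by $2$; (iii) insert a $1$ immediately after one of the $2$'s of the head of $v$ (the head is the longest block of $2$'s at the left end). A function $\varphi:\mathbb{YF}\to\mathbb R$ is harmonic if $\varphi(u)=\sum_{w:\,u\nearrow w}\varphi(w)$ for all $u$, and normalized if $\varphi(\varnothing)=1$. Let $d(v,w)$ be the number of oriented paths $v\nearrow\cdots\nearrow w$ and $K(v,w)=d(v,w)/d(\varnothing,w)$. With the topology of pointwise convergence on functions on $\mathbb{YF}$, the Martin boundary of $\mathbb{YF}$ is the closure of the set $\{K(\cdot,w):w\in\mathbb{YF}\}$ minus that set. *Parameter space.* The position of a letter $2$ in a finite word, or in an infinite (to the left) word, is one more than the rank of the part of the word to its right. An infinite word $w$ with $2$'s at positions $d_1<d_2<\cdots$ is summable if $\sum_j 1/d_j<\infty$; then put $\pi(w)=\prod_{d_j\ge2}(1-1/d_j)>0$.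 Let $\Omega$ be the union of a point $P$ and the set of pairs $(\beta,w)$ with $0<\beta\le1$ and $w$ a summable infinite word. Set $g(P)=0$ and $g(\beta,w)=\beta\,\pi(w)$. The topology of $\Omega$ is the sequential topology determined by the following convergence: a sequence $(\omega_n)$ converges to $P$ iff $g(\omega_n)\to0$; it converges to $(\beta,w)$ iff $g(\omega_n)\to\beta\,\pi(w)$ and the words $w^{(n)}$ of $\omega_n$ (defined for all large $n$) converge to $w$ digitwise. *Functions.* Let $\varphi_P(v)=d(\varnothing,v)/|v|!$. In $R=\mathbb Q\langle X,Y\rangle$ put, for $v=1^{k_t}21^{k_{t-1}}2\cdots 21^{k_0}$, $$p_v=\bigl(X^{k_0+2}-(k_0+2)X^{k_0}Y\bigr)\cdots\bigl(X^{k_{t-1}+2}-(k_{t-1}+2)X^{k_{t-1}}Y\bigr)X^{k_t},\qquad s_v=P_{k_0}Q_{k_1}\cdots Q_{k_t},$$ where $P_n$ is the determinant $\sum_\sigma \operatorname{sign}(\sigma)\,a_{\sigma(1)1}\cdots a_{\sigma(n)n}$ of the $n\times n$ tridiagonal matrix with $X$ on the diagonal, $Y$ just above and $1$ just below it, and $Q_n$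 is the determinant, in the same sense, of such a matrix of size $n+1$ with its first column replaced by $(Y,X,0,\dots,0)^{T}$ (so $Q_0=Y$). The $p_v$ form a basis of $R$. For a summable word $w$ with $2$'s at positions $d_j$, let $\varphi_w$ be the linear functional on $R$ with $$\varphi_w(p_u)=\prod_{i=1}^m\ \prod_{\delta_i\le d_j<\delta_{i+1}}\Bigl(1-\frac{\delta_i+1}{d_j}\Bigr),$$ where $\delta_1<\dots<\delta_m$ are the positions of $2$'s in $u$ and $\delta_{m+1}=\infty$; write $\varphi_w(v)=\varphi_w(s_v)$ for $v\in\mathbb{YF}$. For $0<\beta\le1$ let $$\varphi_{\beta,w}(v)=\sum_{k=0}^{n}\frac{\beta^k(1-\beta)^{n-k}}{(n-k)!}\sum_{|u|=k}\varphi_w(u)\,d(u,v),\qquad n=|v|.$$ *Claim.* The map $P\mapsto\varphi_P$, $(\beta,w)\mapsto\varphi_{\beta,w}$ is a homeomorphism of $\Omega$ onto the Martin boundary of $\mathbb{YF}$. Consequently, for each Borel probability measure $M$ on $\Omega$, the integral $\varphi(v)=\int_\Omega\varphi_\omega(v)\,M(d\omega)$, $v\in\mathbb{YF}$, exists and is a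 normalized non-negative harmonic function on $\mathbb{YF}$; conversely, every normalized non-negative harmonic function on $\mathbb{YF}$ has such a representation (with $M$ not necessarily unique). -/

import Mathlib

namespace YoungFibonacci

open Filter Topology MeasureTheory

/-! ### Fibonacci words and the Young–Fibonacci graph -/

/-- The alphabet `{1, 2}`. -/
inductive Letter : Type
  | one : Letter
  | two : Letter
  deriving DecidableEq

/-- The digit of a letter. -/
def Letter.val : Letter → ℕ
  | .one => 1
  | .two => 2

/-- Finite Fibonacci words; the head of the list is the leftmost letter. -/
abbrev Word : Type := List Letter

/-- The rank `|v|`: the sum of the digits. -/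
def rank (v : Word) : ℕ := (v.map Letter.val).sum

/-- `Covers v w` is `v ↗ w`: the word `w` is a successor of `v`. -/
inductive Covers : Word → Word → Prop
  /-- put an extra `1` at the left end -/
  | prepend (v : Word) : Covers v (Letter.one :: v)
  /-- replace the first `1` of the word by `2` -/
  | replace (j : ℕ) (u : Word) :
      Covers (List.replicate j Letter.two ++ Letter.one :: u)
        (List.replicate j Letter.two ++ Letter.two :: u)
  /-- insert `1` after the `(j+1)`-st letter of the head (all these letters being `2`) -/
  | insert (j : ℕ) (u : Word) :
      Covers (List.replicate (j + 1) Letter.two ++ u)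
        (List.replicate (j + 1) Letter.two ++ Letter.one :: u)

/-- The finite set of Fibonacci words of rank `n`. -/
def level : ℕ → Finset Word
  | 0 => {[]}
  | 1 => {[Letter.one]}
  | n + 2 => (level (n + 1)).image (Letter.one :: ·) ∪ (level n).image (Letter.two :: ·)

theorem mem_level (n : ℕ) (v : Word) : v ∈ level n ↔ rank v = n := by
  induction n using level.induct generalizing v with
  | case1 =>
    rcases v with _ | ⟨_ | _, v⟩ <;> simp [level, rank, Letter.val]
  | case2 =>
    rcases v with _ | ⟨_ | _, v⟩
    · simp [level, rank]
    · rcases v with _ | ⟨_ | _, v⟩ <;> simp [level, rank, Letter.val]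
    · simp [level, rank, Letter.val]; omega
  | case3 n ih1 ih2 =>
    rcases v with _ | ⟨_ | _, v⟩
    · simp [level, rank]
    · simp only [level, Finset.mem_union, Finset.mem_image, List.cons.injEq, true_and,
        reduceCtorEq, false_and, and_false, exists_false, or_false, exists_eq_right, ih1]
      simp only [rank, List.map_cons, List.sum_cons, Letter.val]; omega
    · simp only [level, Finset.mem_union, Finset.mem_image, List.cons.injEq, true_and,
        reduceCtorEq, false_and, and_false, exists_false, false_or, exists_eq_right, ih2]
      simp only [rank, List.map_cons, List.sum_cons, Letter.val]; omega

theorem Covers.rank_eq {v w : Word} (h : Covers v w) : rank w = rank v + 1 := by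
  cases h <;> simp [rank, Letter.val] <;> omega

open Classical in
/-- The finite set of successors of a word. -/
noncomputable def successors (v : Word) : Finset Word :=
  (level (rank v + 1)).filter (Covers v)

theorem mem_successors (v w : Word) : w ∈ successors v ↔ Covers v w := by
  simp only [successors, Finset.mem_filter, mem_level, and_iff_right_iff_imp]
  exact Covers.rank_eq

/-! ### Harmonic functions and the Martin boundary -/

/-- Harmonic functions on the graph. -/
def IsHarmonic (φ : Word → ℝ) : Prop :=
  ∀ u, φ u = ∑ w ∈ successors u, φ w

/-- The set `𝓗` of normalized non-negative harmonic functions. -/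
def normalizedHarmonic : Set (Word → ℝ) :=
  {φ | IsHarmonic φ ∧ (∀ v, 0 ≤ φ v) ∧ φ [] = 1}

/-- The dimension function: `dim v w` is the number of oriented paths
`v = v₀ ↗ v₁ ↗ ⋯ ↗ v_k = w`, a path being recorded as the list `v₁, …, v_k`. -/
noncomputable def dim (v w : Word) : ℕ :=
  Set.ncard {l : List Word |
    (v :: l).IsChain Covers ∧ (v :: l).getLast (List.cons_ne_nil v l) = w}

/-- The Martin kernel `K(v, w)`. -/
noncomputable def martinKernel (v w : Word) : ℝ := (dim v w : ℝ) / (dim [] w : ℝ)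

/-- The functions `v ↦ K(v, w)`, one for each vertex `w`. -/
def kernelFunctions : Set (Word → ℝ) :=
  Set.range fun w : Word => fun v : Word => martinKernel v w

/-- The Martin boundary: the closure of the set of functions `K(·, w)` in the topology of
pointwise convergence, minus that set. -/
def martinBoundary : Set (Word → ℝ) := closure kernelFunctions \ kernelFunctions

/-- The Plancherel harmonic function. -/
noncomputable def plancherel (v : Word) : ℝ := (dim [] v : ℝ) / ((rank v).factorial : ℝ)

/-- The contraction `C_τ` of functions on the graph. -/
noncomputable def contraction (τ : ℝ) (φ : Word → ℝ) (v : Word) : ℝ :=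
  ∑ k ∈ Finset.range (rank v + 1),
    τ ^ k * (1 - τ) ^ (rank v - k) / ((rank v - k).factorial : ℝ) *
      ∑ u ∈ level k, φ u * (dim u v : ℝ)

/-! ### The ring of non-commutative polynomials, `s`-functions and `p`-functions -/

/-- `R = ℚ⟨X, Y⟩`; the variable attached to the letter `1` is `X`, the one attached to `2`
is `Y`. -/
abbrev R : Type := FreeAlgebra ℚ Letter

/-- The variable `X`. -/
def X : R := FreeAlgebra.ι ℚ Letter.one

/-- The variable `Y`. -/
def Y : R := FreeAlgebra.ι ℚ Letter.two

/-- The non-commutative determinant: in each term the `k`-th factor comes from the `k`-th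
column. -/
noncomputable def ncDet {n : ℕ} (A : Matrix (Fin n) (Fin n) R) : R :=
  ∑ σ : Equiv.Perm (Fin n),
    ((Equiv.Perm.sign σ : ℤ) : R) * (List.ofFn fun k => A (σ k) k).prod

/-- The tridiagonal `n × n` matrix with `X` on the diagonal, `Y` above it and `1` below it. -/
noncomputable def matP (n : ℕ) : Matrix (Fin n) (Fin n) R := fun i j =>
  if (i : ℕ) = j then X
  else if (j : ℕ) = i + 1 then Y
  else if (i : ℕ) = j + 1 then 1
  else 0

/-- The same matrix of size `n + 1`, with first column replaced by `(Y, X, 0, …, 0)`. -/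
noncomputable def matQ (n : ℕ) : Matrix (Fin (n + 1)) (Fin (n + 1)) R := fun i j =>
  if (j : ℕ) = 0 then
    (if (i : ℕ) = 0 then Y else if (i : ℕ) = 1 then X else 0)
  else matP (n + 1) i j

/-- `P_n`, of degree `n`. -/
noncomputable def P (n : ℕ) : R := ncDet (matP n)

/-- `Q_n`, of degree `n + 2`. -/
noncomputable def Q (n : ℕ) : R := ncDet (matQ n)

/-- The exponents of `v = 1^{k_t} 2 1^{k_{t-1}} ⋯ 2 1^{k_0}`, as the pair
`(k_t, [k_{t-1}, …, k_0])`. -/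
def exponents : Word → ℕ × List ℕ
  | [] => (0, [])
  | .one :: v => ((exponents v).1 + 1, (exponents v).2)
  | .two :: v => (0, (exponents v).1 :: (exponents v).2)

/-- `P_{k_0} Q_{k_1} ⋯ Q_{k_t}`, for the list `[k_0, k_1, …, k_t]`. -/
noncomputable def sOfList : List ℕ → R
  | [] => 1
  | k :: l => P k * (l.map Q).prod

/-- The Okada–Schur polynomial `s_v = P_{k_0} Q_{k_1} ⋯ Q_{k_t}`. -/
noncomputable def s (v : Word) : R :=
  sOfList ((exponents v).1 :: (exponents v).2).reverse

/-- The factor `X^{k+2} - (k+2) X^k Y`. -/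
noncomputable def pFactor (k : ℕ) : R := X ^ (k + 2) - ((k + 2 : ℕ) : R) * (X ^ k * Y)

/-- The polynomial
`p_v = (X^{k_0+2} - (k_0+2) X^{k_0} Y) ⋯ (X^{k_{t-1}+2} - (k_{t-1}+2) X^{k_{t-1}} Y) X^{k_t}`. -/
noncomputable def p (v : Word) : R :=
  ((exponents v).2.reverse.map pFactor).prod * X ^ (exponents v).1

theorem p_nil : p [] = 1 := by simp [p, exponents]

theorem p_one (v : Word) : p (.one :: v) = p v * X := by
  simp [p, exponents, pow_succ, mul_assoc]

theorem p_two (v : Word) :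
    p (.two :: v) = p v * X * X - (((exponents v).1 + 2 : ℕ) : ℚ) • (p v * Y) := by
  have h : ∀ (n : ℕ) (r : R), ((n : ℕ) : R) * r = (n : ℚ) • r := fun n r => by
    rw [Algebra.smul_def, map_natCast]
  simp only [p, exponents, List.reverse_cons, List.map_append, List.prod_append, List.map_cons,
    List.map_nil, List.prod_cons, List.prod_nil, mul_one, pow_zero, pFactor, h, mul_sub,
    mul_smul_comm, pow_succ, mul_assoc]

/-- Right multiplication by `X` or `Y` in the coordinates given by the polynomials `p_v`. -/
noncomputable def coordMul : Letter → Module.End ℚ (Word →₀ ℚ)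
  | .one => Finsupp.lift _ ℚ Word fun v => Finsupp.single (.one :: v) 1
  | .two => Finsupp.lift _ ℚ Word fun v =>
      (((exponents v).1 + 2 : ℕ) : ℚ)⁻¹ •
        (Finsupp.single (.one :: .one :: v) 1 - Finsupp.single (.two :: v) 1)

/-- The right action of `R` on coordinates. -/
noncomputable def coordAct : R →ₐ[ℚ] (Module.End ℚ (Word →₀ ℚ))ᵐᵒᵖ :=
  FreeAlgebra.lift ℚ fun a => MulOpposite.op (coordMul a)

/-- The coordinates of a polynomial in the system `(p_v)`. -/
noncomputable def coord : R →ₗ[ℚ] (Word →₀ ℚ) where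
  toFun r := (coordAct r).unop (Finsupp.single [] 1)
  map_add' _ _ := by simp
  map_smul' _ _ := by simp

theorem coordMul_one (v : Word) :
    coordMul .one (Finsupp.single v 1) = Finsupp.single (.one :: v) 1 := by
  simp [coordMul]

theorem coordMul_two (v : Word) :
    coordMul .two (Finsupp.single v 1) = (((exponents v).1 + 2 : ℕ) : ℚ)⁻¹ •
        (Finsupp.single (.one :: .one :: v) 1 - Finsupp.single (.two :: v) 1) := by
  simp [coordMul]

theorem linearCombination_coordAct (r : R) : ∀ f : Word →₀ ℚ,
    Finsupp.linearCombination ℚ p ((coordAct r).unop f) =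
      Finsupp.linearCombination ℚ p f * r := by
  induction r using FreeAlgebra.induction with
  | grade0 q =>
    intro f
    simp [AlgHom.commutes, MulOpposite.algebraMap_apply, Module.algebraMap_end_apply,
      Algebra.smul_def, Algebra.commutes q]
  | grade1 a =>
    intro f
    have key : (Finsupp.linearCombination ℚ p) ∘ₗ coordMul a =
        (LinearMap.mulRight ℚ (FreeAlgebra.ι ℚ a)) ∘ₗ Finsupp.linearCombination ℚ p := by
      refine Finsupp.lhom_ext' fun v => LinearMap.ext_ring ?_
      cases a with
      | one => simp [coordMul_one, p_one, X]
      | two =>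
        have hne : (((exponents v).1 + 2 : ℕ) : ℚ) ≠ 0 := by positivity
        simp only [LinearMap.comp_apply, Finsupp.lsingle_apply, coordMul_two, map_smul, map_sub,
          Finsupp.linearCombination_single, one_smul, p_one, p_two, sub_sub_cancel,
          LinearMap.mulRight_apply, inv_smul_smul₀ hne, Y]
    simpa [coordAct] using LinearMap.congr_fun key f
  | mul a b ha hb =>
    intro f
    simp [hb, ha, mul_assoc]
  | add a b ha hb =>
    intro f
    simp [hb, ha, mul_add]

theorem coord_p (v : Word) : coord (p v) = Finsupp.single v 1 := by
  have hX : ∀ r : R, coord (r * X) = coordMul .one (coord r) := fun r => by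
    simp [coord, X, coordAct]
  have hY : ∀ r : R, coord (r * Y) = coordMul .two (coord r) := fun r => by
    simp [coord, Y, coordAct]
  induction v with
  | nil => simp [p_nil, coord]
  | cons a v ih =>
    cases a with
    | one => rw [p_one, hX, ih, coordMul_one]
    | two =>
      have hne : (((exponents v).1 + 2 : ℕ) : ℚ) ≠ 0 := by positivity
      rw [p_two, map_sub, map_smul, hX, hX, hY, ih, coordMul_one, coordMul_one, coordMul_two,
        smul_inv_smul₀ hne, sub_sub_cancel]

/-- The polynomials `p_v` form a basis of `R`. -/
noncomputable def pBasis : Module.Basis Word ℚ R :=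
  Module.Basis.ofRepr
    (LinearEquiv.ofLinearMap coord (Finsupp.linearCombination ℚ p)
      (by
        refine Finsupp.lhom_ext' fun v => LinearMap.ext_ring ?_
        simp [coord_p])
      (by
        refine LinearMap.ext fun r => ?_
        have h := linearCombination_coordAct r (Finsupp.single [] 1)
        simpa [p_nil, coord] using h))

theorem pBasis_apply (v : Word) : pBasis v = p v := by
  rw [pBasis, Module.Basis.coe_ofRepr]
  simp

/-! ### Summable infinite words and the functions `φ_w` -/

/-- Infinite words, infinite to the left: `w i` is the letter with exactly `i` letters to its
right. -/
abbrev InfWord : Type := ℕ → Letter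

/-- The positions of the `2`s in a finite word `v`: for `v = a 2 b` the position of the
indicated `2` is `|b| + 1`. -/
def positions : Word → Finset ℕ
  | [] => ∅
  | .one :: v => positions v
  | .two :: v => insert (rank v + 1) (positions v)

/-- The positions of the `2`s in an infinite word. -/
def InfWord.positions (w : InfWord) : Set ℕ :=
  {d | ∃ i, w i = Letter.two ∧ d = (∑ j ∈ Finset.range i, (w j).val) + 1}

/-- An infinite word is summable if `∑ 1 / d_j < ∞`, where `d_j` are the positions of its
`2`s. -/
def InfWord.IsSummable (w : InfWord) : Prop :=
  Summable fun d : w.positions => (1 : ℝ) / (d : ℕ)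

/-- `π(w) = ∏_{d_j ≥ 2} (1 - 1 / d_j)`. -/
noncomputable def InfWord.pi (w : InfWord) : ℝ :=
  ∏' d : {d : ℕ // d ∈ w.positions ∧ 2 ≤ d}, (1 - 1 / ((d : ℕ) : ℝ))

/-- The number `φ_w(p_u) = ∏_i ∏_{δ_i ≤ d_j < δ_{i+1}} (1 - (δ_i + 1) / d_j)`, where
`δ_1 < ⋯ < δ_m` are the positions of the `2`s in `u`, `δ_{m+1} = ∞`, and `d_j` are those
of `w`. -/
noncomputable def pValue (w : InfWord) (u : Word) : ℝ :=
  ∏ δ ∈ positions u,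
    ∏' d : {d : ℕ // d ∈ w.positions ∧ δ ≤ d ∧ ∀ δ' ∈ positions u, δ < δ' → d < δ'},
      (1 - ((δ : ℝ) + 1) / ((d : ℕ) : ℝ))

/-- The linear functional `φ_w` on `R` with the prescribed values on the basis `(p_u)`. -/
noncomputable def functional (w : InfWord) : R →ₗ[ℚ] ℝ := pBasis.constr ℚ (pValue w)

theorem functional_p (w : InfWord) (u : Word) : functional w (p u) = pValue w u := by
  rw [functional, ← pBasis_apply, Module.Basis.constr_basis]

/-- The function `φ_w` on the graph: `φ_w(v)` is the value of the functional at `s_v`. -/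
noncomputable def phiWord (w : InfWord) (v : Word) : ℝ := functional w (s v)

/-! ### The parameter space -/

/-- The set `Ω`: a point `P` and the pairs `(β, w)` with `0 < β ≤ 1` and `w` summable. -/
inductive Omega : Type
  | P : Omega
  | pair (β : ℝ) (w : InfWord) (hβ : 0 < β) (hβ' : β ≤ 1) (hw : w.IsSummable) : Omega

namespace Omega

/-- The number `β π(w)` attached to `(β, w)`; it is `0` at the point `P`. -/
noncomputable def weight : Omega → ℝ
  | P => 0
  | pair β w _ _ _ => β * w.pi

/-- The `i`-th letter of the word of a point of `Ω` other than `P` is `a`. -/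
def HasLetter (i : ℕ) (a : Letter) : Omega → Prop
  | P => False
  | pair _ w _ _ _ => w i = a

/-- The convergent sequences of `Ω`: convergence to `P` is `β⁽ⁿ⁾ π(w⁽ⁿ⁾) → 0`, and convergence
to `(β, w)` is digitwise convergence `w⁽ⁿ⁾ → w` together with
`β⁽ⁿ⁾ π(w⁽ⁿ⁾) → β π(w)`. -/
def Converges (x : ℕ → Omega) : Omega → Prop
  | P => Tendsto (fun n => (x n).weight) atTop (𝓝 0)
  | pair β w _ _ _ =>
      (∀ i, ∀ᶠ n in atTop, (x n).HasLetter i (w i)) ∧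
        Tendsto (fun n => (x n).weight) atTop (𝓝 (β * w.pi))

/-- The topology of `Ω` determined by its convergent sequences. -/
instance : TopologicalSpace Omega where
  IsOpen U := ∀ ω ∈ U, ∀ x : ℕ → Omega, Converges x ω → ∀ᶠ n in atTop, x n ∈ U
  isOpen_univ := fun _ _ _ _ => by simp
  isOpen_inter := fun _ _ hU hV ω hω x hx => (hU ω hω.1 x hx).and (hV ω hω.2 x hx)
  isOpen_sUnion := fun _ hS ω ⟨U, hU, hω⟩ x hx =>
    (hS U hU ω hω x hx).mono fun _ hn => ⟨U, hU, hn⟩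

/-- In this topology exactly the prescribed sequences converge. -/
theorem tendsto_iff_converges (x : ℕ → Omega) (ω : Omega) :
    Tendsto x atTop (𝓝 ω) ↔ Converges x ω := by
  have hw : ∀ (x : ℕ → Omega) (ω : Omega), Converges x ω →
      Tendsto (fun n => (x n).weight) atTop (𝓝 ω.weight) := by
    intro x ω h
    cases ω with
    | P => exact h
    | pair β w h1 h2 h3 => exact h.2
  constructor
  · intro h
    have hcont : Continuous weight := by
      refine ⟨fun V hV ω hω y hy => ?_⟩
      exact (hw y ω hy).eventually (hV.mem_nhds hω)
    have hlim := (hcont.tendsto ω).comp h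
    cases ω with
    | P => exact hlim
    | pair β w h1 h2 h3 =>
      refine ⟨fun i => ?_, hlim⟩
      have hopen : IsOpen {ω : Omega | ω.HasLetter i (w i)} := by
        intro ω hω y hy
        cases ω with
        | P => exact hω.elim
        | pair β' w' h1' h2' h3' =>
          have hω' : w' i = w i := hω
          have := hy.1 i
          rwa [hω'] at this
      exact h.eventually (hopen.mem_nhds (show w i = w i from rfl))
  · intro h
    rw [tendsto_nhds]
    intro U hU hω
    exact hU ω hω x h

instance : MeasurableSpace Omega := borel Omega

instance : BorelSpace Omega := ⟨rfl⟩

/-- The map `ω ↦ φ_ω`: `P ↦ φ_P` and `(β, w) ↦ φ_{β, w} = C_β(φ_w)`. -/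
noncomputable def phi : Omega → Word → ℝ
  | P => plancherel
  | pair β w _ _ _ => contraction β (phiWord w)

end Omega

end YoungFibonacci

namespace YoungFibonacci

open Filter Topology MeasureTheory

/-! ### Expansion of the non-commutative determinants -/

/-! The graph is encoded in `R`. Right multiplication by `X` takes `s v` to the sum of `s w` over
the successors of `v` (`s_mul_X`), so a functional `ψ` with `ψ (f * X) = ψ f` gives a harmonic
function `v ↦ ψ (s v)`. On the basis `p u` this condition says only that leading `1`s of `u` do not
matter.

The bridge to the Martin kernel is an orthogonality relation: the functional of a finite word `w`,
padded by `1`s, kills `s v` for every other `v` of the same rank (`Word.functional_pad_s_eq_zero`).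
Harmonicity and normalization then make `K(·, w)` agree, on ranks up to `rank w`, with the function
of the point `(1, ⋯ 1 1 w)` (`Omega.phi_ofWord`). The contraction by `β` multiplies the value at `p
u` by `β ^ coreRank u` (`contraction_eq`).

For the topology, `φ_w(p_u)` is `π(w) ^ coreRank u` times a product whose factors are `1 + O(1/d²)`.
That product is continuous on the compact space of all infinite words (`continuous_ratio`), so a
function `φ_ω` depends continuously on the pair (weight, word). Zeros and signs at the words `2 1^k`
recover the positions of `2`s and then `β` (`value_injective`). A limit of points with positive
limiting weight is again a point of `Ω`, because bounded-below partial products of `π` force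
summability (`exists_converges_subseq`). Every point is a limit of finite words, obtained by
truncating and then prepending `2`s to tune `π` (`exists_converges_ofWord`).

No kernel `K(·, w)` is harmonic, whereas every `φ_ω` is. Kernels converging to a function that is
not itself a kernel have ranks tending to infinity. Hence the image is exactly the boundary, and
compactness with injectivity makes the inverse continuous. For the integral representation, a
harmonic function is on low ranks a finite mixture of the functions of the points `(1, ⋯ 1 1 w)`
with `w` of rank `n`; a weak limit of these mixing measures on the compact space `Ω` represents it
everywhere. -/

/-- Expansion along the first column. -/
theorem ncDet_succ_column_zero {n : ℕ} (A : Matrix (Fin (n + 1)) (Fin (n + 1)) R) :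
    ncDet A = ∑ i : Fin (n + 1),
      (-1) ^ (i : ℕ) * (A i 0 * ncDet (A.submatrix i.succAbove Fin.succ)) := by
  -- Integers are central, so signs move past the entries. The column-zero entry is already the
  -- leftmost factor of each term, so nothing else has to commute.
  have hc : ∀ (z : ℤ) (a b : R), a * (z * b) = (z : R) * (a * b) := fun z a b => by
    rw [← mul_assoc, ← Int.cast_comm z a, mul_assoc]
  conv_lhs => rw [ncDet, Finset.univ_perm_fin_succ, ← Finset.univ_product_univ]
  simp only [Finset.sum_map, Equiv.toEmbedding_apply, Finset.sum_product]
  refine Finset.sum_congr rfl fun i _ => Fin.cases ?_ (fun i => ?_) i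
  · simp only [ncDet, List.ofFn_succ, List.prod_cons, Equiv.Perm.decomposeFin_symm_apply_zero,
      Equiv.Perm.decomposeFin.symm_sign, Equiv.Perm.decomposeFin_symm_apply_succ,
      Equiv.swap_self, Equiv.refl_apply, if_true, Fin.val_zero, pow_zero, one_mul,
      Finset.mul_sum, Matrix.submatrix_apply, Fin.succAbove_zero, hc]
  · rw [ncDet, Finset.mul_sum, Finset.mul_sum]
    -- After deleting row `i + 1`, the remaining rows are reordered by `cycleRange i`, whose sign
    -- combines with the sign of the swap to give the cofactor sign.
    refine Fintype.sum_equiv (Equiv.mulLeft (Fin.cycleRange i)) _ _ fun σ => ?_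
    have h1 : (-1 : R) ^ ((Fin.succ i : Fin (n + 1)) : ℕ) = (((-1) ^ ((i : ℕ) + 1) : ℤ) : R) := by
      push_cast; rfl
    rw [hc, ← mul_assoc, h1, ← Int.cast_mul]
    simp only [List.ofFn_succ, List.prod_cons, Equiv.Perm.decomposeFin_symm_apply_zero,
      Equiv.Perm.decomposeFin.symm_sign, Equiv.Perm.decomposeFin_symm_apply_succ,
      Matrix.submatrix_apply, Equiv.coe_mulLeft, Equiv.Perm.mul_apply, Fin.succAbove_cycleRange,
      if_neg (Fin.succ_ne_zero i)]
    congr 2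
    simp only [map_mul, Units.val_mul, Fin.sign_cycleRange, Units.val_pow_eq_pow_val,
      Units.val_neg, Units.val_one]
    rcases Nat.even_or_odd (i : ℕ) with h | h <;> simp [pow_succ, h.neg_one_pow]

theorem ncDet_zero (A : Matrix (Fin 0) (Fin 0) R) : ncDet A = 1 := by
  simp [ncDet]

/-- Expansion along a first column that vanishes below its first entry. -/
theorem ncDet_eq_of_column_one {n : ℕ} (A : Matrix (Fin (n + 1)) (Fin (n + 1)) R)
    (h : ∀ i : Fin n, A i.succ 0 = 0) :
    ncDet A = A 0 0 * ncDet (A.submatrix Fin.succ Fin.succ) := by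
  rw [ncDet_succ_column_zero, Fin.sum_univ_succ]
  simp [h, Fin.succAbove_zero]

/-- Expansion along a first column that vanishes below its second entry. -/
theorem ncDet_eq_of_column_two {n : ℕ} (A : Matrix (Fin (n + 2)) (Fin (n + 2)) R)
    (h : ∀ i : Fin n, A i.succ.succ 0 = 0) :
    ncDet A = A 0 0 * ncDet (A.submatrix Fin.succ Fin.succ) -
      A 1 0 * ncDet (A.submatrix (Fin.succAbove 1) Fin.succ) := by
  rw [ncDet_succ_column_zero, Fin.sum_univ_succ, Fin.sum_univ_succ]
  simp [h, Fin.succAbove_zero, sub_eq_add_neg]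

theorem ncDet_eq_zero_of_row {n : ℕ} (A : Matrix (Fin n) (Fin n) R) (i : Fin n)
    (h : ∀ j, A i j = 0) : ncDet A = 0 := by
  refine Finset.sum_eq_zero fun σ _ => ?_
  rw [List.prod_eq_zero (List.mem_ofFn.2 ⟨σ.symm i, by simp [h]⟩), mul_zero]

theorem matP_submatrix_succ (n : ℕ) : (matP (n + 1)).submatrix Fin.succ Fin.succ = matP n := by
  ext i j; simp [matP]

/-- The first column of the minor has `Y` on top and at most a `1` below it; the cofactor of that
`1` has a zero top row because the matrix is tridiagonal. -/
theorem ncDet_matP_minor (n : ℕ) :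
    ncDet ((matP (n + 2)).submatrix (Fin.succAbove 1) Fin.succ) = Y * P n := by
  cases n with
  | zero =>
    rw [ncDet_eq_of_column_one _ (fun i => i.elim0), P, ncDet_zero, ncDet_zero]
    simp [matP]
  | succ n =>
    rw [ncDet_eq_of_column_two]
    · rw [ncDet_eq_zero_of_row (((matP (n + 1 + 2)).submatrix (Fin.succAbove 1)
        Fin.succ).submatrix (Fin.succAbove 1) Fin.succ) 0]
      · rw [mul_zero, sub_zero]
        congr 1
        rw [P]; congr 1; ext i j
        have h : (Fin.succAbove (1 : Fin (n + 3)) i.succ) = i.succ.succ := by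
          rw [← Fin.succ_zero_eq_one, Fin.succ_succAbove_succ, Fin.succAbove_zero]
        simp [matP, h]
      · intro j
        have h : (Fin.succAbove (1 : Fin (n + 3)) (Fin.succAbove (1 : Fin (n + 2)) 0)) = 0 := by
          simp
        simp [matP]
    · intro i
      have h : (Fin.succAbove (1 : Fin (n + 3)) i.succ.succ) = i.succ.succ.succ := by
        rw [← Fin.succ_zero_eq_one, Fin.succ_succAbove_succ, Fin.succAbove_zero]
      simp [matP, h]

theorem P_zero : P 0 = 1 := ncDet_zero _

theorem P_one : P 1 = X := by
  rw [P, ncDet_eq_of_column_one _ (fun i => i.elim0), ncDet_zero]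
  simp [matP]

theorem P_add_two_left (n : ℕ) : P (n + 2) = X * P (n + 1) - Y * P n := by
  rw [P, ncDet_eq_of_column_two, matP_submatrix_succ, ncDet_matP_minor]
  · simp [matP, P]
  · intro i; simp [matP]

theorem Q_zero : Q 0 = Y := by
  rw [Q, ncDet_eq_of_column_one _ (fun i => i.elim0), ncDet_zero]
  simp [matQ]

theorem Q_succ (n : ℕ) : Q (n + 1) = Y * P (n + 1) - X * (Y * P n) := by
  rw [Q, ncDet_eq_of_column_two]
  · congr 1
    · congr 1
      rw [P, ← matP_submatrix_succ (n + 1)]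
      congr 1
    · congr 1
      rw [← ncDet_matP_minor]
      congr 1
  · intro i; simp [matQ]

/-- Column expansion puts the new factor on the left, but the theory uses right multiplication. The
left and right recursions commute with each other, so the right one propagates by induction. -/
theorem P_add_two (n : ℕ) : P (n + 2) = P (n + 1) * X - P n * Y := by
  induction n using Nat.strong_induction_on with
  | _ n ih =>
    rcases n with _ | _ | n
    · rw [P_add_two_left]; simp [P_zero, P_one]
    · rw [P_add_two_left, P_add_two_left 0]; simp only [P_zero, P_one, zero_add]; noncomm_ring
    · calc P (n + 4) = X * P (n + 3) - Y * P (n + 2) := P_add_two_left (n + 2)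
        _ = X * (P (n + 2) * X - P (n + 1) * Y) - Y * (P (n + 1) * X - P n * Y) := by
          rw [ih (n + 1) (by omega), ih n (by omega)]
        _ = (X * P (n + 2) - Y * P (n + 1)) * X - (X * P (n + 1) - Y * P n) * Y := by
          noncomm_ring
        _ = P (n + 3) * X - P (n + 2) * Y := by
          rw [← P_add_two_left (n + 1), ← P_add_two_left n]

theorem Q_one : Q 1 = Y * X - X * Y := by
  rw [Q_succ, P_one, P_zero, mul_one]

theorem Q_add_two (n : ℕ) : Q (n + 2) = Q (n + 1) * X - Q n * Y := by
  rcases n with _ | n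
  · rw [Q_succ, P_add_two, P_one, P_zero, Q_one, Q_zero]; noncomm_ring
  · rw [Q_succ, Q_succ, Q_succ, P_add_two (n + 1), P_add_two n]; noncomm_ring

/-! ### Recursion for the `s`-functions -/

theorem s_nil : s [] = 1 := by simp [s, exponents, sOfList, P_zero]

theorem s_singleton : s [Letter.one] = X := by simp [s, exponents, sOfList, P_one]

theorem sOfList_append_singleton {l : List ℕ} (hl : l ≠ []) (k : ℕ) :
    sOfList (l ++ [k]) = sOfList l * Q k := by
  cases l with
  | nil => exact absurd rfl hl
  | cons a l => simp [sOfList, mul_assoc]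

theorem s_two (v : Word) : s (.two :: v) = s v * Y := by
  simp only [s, exponents]
  rw [List.reverse_cons, sOfList_append_singleton (by simp), Q_zero]

theorem s_one_one (v : Word) : s (.one :: .one :: v) = s (.one :: v) * X - s v * Y := by
  simp only [s, exponents, List.reverse_cons]
  rcases h : (exponents v).2.reverse with _ | ⟨a, l⟩
  · simp [sOfList, P_add_two]
  · rw [sOfList_append_singleton (by simp), sOfList_append_singleton (by simp),
      sOfList_append_singleton (by simp), Q_add_two]
    noncomm_ring

theorem s_one_two (v : Word) : s (.one :: .two :: v) = s (.two :: v) * X - s v * X * Y := by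
  have h : s (.one :: .two :: v) = s v * Q 1 := by
    simp only [s, exponents]
    rw [List.reverse_cons, sOfList_append_singleton (by simp)]
  rw [h, s_two, Q_one]; noncomm_ring

/-! ### Recursion for the successors -/

theorem covers_nil_iff (w : Word) : Covers [] w ↔ w = [Letter.one] := by
  constructor
  · intro h
    generalize hv : ([] : Word) = v at h
    cases h with
    | prepend => rw [← hv]
    | replace j u => simp at hv
    | insert j u => simp [List.replicate_succ] at hv
  · rintro rfl; exact Covers.prepend []

theorem covers_one_iff (v w : Word) :
    Covers (.one :: v) w ↔ w = .one :: .one :: v ∨ w = .two :: v := by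
  constructor
  · intro h
    generalize hv : (Letter.one :: v : Word) = x at h
    cases h with
    | prepend => left; rw [← hv]
    | replace j u =>
      rcases j with _ | j
      · simp at hv; simp [hv]
      · simp [List.replicate_succ] at hv
    | insert j u => simp [List.replicate_succ] at hv
  · rintro (rfl | rfl)
    · exact Covers.prepend _
    · exact Covers.replace 0 v

theorem covers_two_iff (v w : Word) :
    Covers (.two :: v) w ↔ w = .one :: .two :: v ∨ ∃ x, Covers v x ∧ w = .two :: x := by
  constructor
  · intro h
    generalize hv : (Letter.two :: v : Word) = x at h
    cases h with
    | prepend => left; rw [← hv]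
    | replace j u =>
      rcases j with _ | j
      · simp at hv
      · simp [List.replicate_succ] at hv
        right; subst hv
        exact ⟨_, Covers.replace j u, by simp [List.replicate_succ]⟩
    | insert j u =>
      right
      simp [List.replicate_succ] at hv
      subst hv
      rcases j with _ | j
      · exact ⟨_, Covers.prepend _, by simp⟩
      · exact ⟨_, Covers.insert j u, by simp [List.replicate_succ]⟩
  · rintro (rfl | ⟨x, hx, rfl⟩)
    · exact Covers.prepend _
    · cases hx with
      | prepend => exact Covers.insert 0 v
      | replace j u => exact Covers.replace (j + 1) u
      | insert j u => exact Covers.insert (j + 1) u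

theorem sum_successors_nil {M : Type*} [AddCommMonoid M] (f : Word → M) :
    ∑ w ∈ successors [], f w = f [Letter.one] := by
  have h : successors [] = {[Letter.one]} := by
    ext w; rw [mem_successors, covers_nil_iff, Finset.mem_singleton]
  rw [h, Finset.sum_singleton]

theorem sum_successors_one {M : Type*} [AddCommMonoid M] (f : Word → M) (v : Word) :
    ∑ w ∈ successors (.one :: v), f w = f (.one :: .one :: v) + f (.two :: v) := by
  have h : successors (.one :: v) = {.one :: .one :: v, .two :: v} := by
    ext w; rw [mem_successors, covers_one_iff, Finset.mem_insert, Finset.mem_singleton]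
  rw [h, Finset.sum_pair (by simp)]

theorem sum_successors_two {M : Type*} [AddCommMonoid M] (f : Word → M) (v : Word) :
    ∑ w ∈ successors (.two :: v), f w =
      f (.one :: .two :: v) + ∑ x ∈ successors v, f (.two :: x) := by
  have h : successors (.two :: v) =
      insert (.one :: .two :: v) ((successors v).image (.two :: ·)) := by
    ext w
    simp only [mem_successors, covers_two_iff, Finset.mem_insert, Finset.mem_image]
    constructor
    · rintro (h | ⟨x, hx, rfl⟩)
      · exact Or.inl h
      · exact Or.inr ⟨x, hx, rfl⟩
    · rintro (h | ⟨x, hx, rfl⟩)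
      · exact Or.inl h
      · exact Or.inr ⟨x, hx, rfl⟩
  rw [h, Finset.sum_insert (by simp), Finset.sum_image (by simp)]

/-- The recursions for successors of `1v` and `2v` match those for `s`: in the second case the sum
over successors of `v` becomes `s v * X * Y` by induction. -/
theorem s_mul_X (v : Word) : s v * X = ∑ w ∈ successors v, s w := by
  induction v with
  | nil => rw [sum_successors_nil, s_nil, s_singleton, one_mul]
  | cons a v ih =>
    cases a with
    | one => rw [sum_successors_one, s_one_one, s_two, sub_add_cancel]
    | two =>
      rw [sum_successors_two, s_one_two]
      simp only [s_two v, s_two]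
      rw [← Finset.sum_mul, ← ih, sub_add_cancel]

/-- This reflection is the differential-poset property of the graph; it makes `lower (s (2v)) = s v
* X` a sum over predecessors. -/
theorem covers_two_right_iff (u v : Word) : Covers u (.two :: v) ↔ Covers v u := by
  induction hn : rank v using Nat.strong_induction_on generalizing u v with
  | _ n ih =>
    rcases u with _ | ⟨_ | _, u⟩
    · rw [covers_nil_iff]
      simp only [List.cons.injEq, reduceCtorEq, false_and, false_iff]
      intro h; have := h.rank_eq; simp [rank] at this
    · rw [covers_one_iff]
      simp only [List.cons.injEq, reduceCtorEq, false_and, false_or, true_and]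
      constructor
      · rintro rfl; exact Covers.prepend _
      · intro h
        rcases v with _ | ⟨_ | _, v⟩
        · rw [covers_nil_iff] at h; simpa using h.symm
        · rw [covers_one_iff] at h; exact Eq.symm (by simpa using h)
        · rw [covers_two_iff] at h; exact Eq.symm (by simpa using h)
    · rw [covers_two_iff]
      simp only [List.cons.injEq, reduceCtorEq, false_and, false_or, true_and, exists_eq_right']
      rcases v with _ | ⟨_ | _, v⟩
      · rw [covers_nil_iff]
        simp only [List.cons.injEq, reduceCtorEq, false_and, iff_false]
        intro h; have := h.rank_eq; simp [rank] at this
      · rw [covers_one_iff]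
        simp only [List.cons.injEq, reduceCtorEq, false_and, false_or, true_and]
        constructor
        · intro h
          rcases u with _ | ⟨_ | _, u⟩
          · rw [covers_nil_iff] at h; simpa using h.symm
          · rw [covers_one_iff] at h; exact Eq.symm (by simpa using h)
          · rw [covers_two_iff] at h; exact Eq.symm (by simpa using h)
        · rintro rfl; exact Covers.prepend _
      · rw [covers_two_iff]
        simp only [List.cons.injEq, reduceCtorEq, false_and, false_or, true_and, exists_eq_right']
        exact ih (rank v) (by rw [← hn]; simp [rank, Letter.val]) u v rfl

theorem covers_one_right_iff (u v : Word) : Covers u (.one :: v) ↔ u = v := by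
  rcases u with _ | ⟨_ | _, u⟩
  · rw [covers_nil_iff]; simp [eq_comm]
  · rw [covers_one_iff]; simp [eq_comm]
  · rw [covers_two_iff]; simp [eq_comm]

/-! ### The grading and the lowering operator -/

theorem rank_one (v : Word) : rank (.one :: v) = rank v + 1 := by
  simp [rank, Letter.val]; omega

theorem rank_two (v : Word) : rank (.two :: v) = rank v + 2 := by
  simp [rank, Letter.val]; omega

theorem p_mul_X (u : Word) : p u * X = p (.one :: u) := (p_one u).symm

theorem p_mul_Y (u : Word) : p u * Y =
    (((exponents u).1 + 2 : ℕ) : ℚ)⁻¹ • (p (.one :: .one :: u) - p (.two :: u)) := by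
  have hne : (((exponents u).1 + 2 : ℕ) : ℚ) ≠ 0 := by positivity
  rw [p_two, p_one, p_one, sub_sub_cancel, inv_smul_smul₀ hne]

/-- The homogeneous component of degree `n`. -/
noncomputable def homogeneous (n : ℕ) : Submodule ℚ R :=
  Submodule.span ℚ (p '' {u | rank u = n})

theorem p_mem_homogeneous (u : Word) : p u ∈ homogeneous (rank u) :=
  Submodule.subset_span ⟨u, rfl, rfl⟩

theorem homogeneous_induction {M : Type*} [AddCommGroup M] [Module ℚ M] {n : ℕ}
    {F G : R →ₗ[ℚ] M} (h : ∀ u, rank u = n → F (p u) = G (p u)) {f : R}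
    (hf : f ∈ homogeneous n) : F f = G f := by
  refine LinearMap.eqOn_span (s := p '' {u | rank u = n}) ?_ hf
  rintro _ ⟨u, hu, rfl⟩
  exact h u hu

theorem homogeneous_le_comap {n m : ℕ} {F : R →ₗ[ℚ] R}
    (h : ∀ u, rank u = n → F (p u) ∈ homogeneous m) {f : R} (hf : f ∈ homogeneous n) :
    F f ∈ homogeneous m := by
  have : homogeneous n ≤ (homogeneous m).comap F := by
    rw [homogeneous, Submodule.span_le]
    rintro _ ⟨u, hu, rfl⟩
    exact h u hu
  exact this hf

theorem mul_X_mem_homogeneous {n : ℕ} {f : R} (hf : f ∈ homogeneous n) :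
    f * X ∈ homogeneous (n + 1) := by
  refine homogeneous_le_comap (F := LinearMap.mulRight ℚ X) (fun u hu => ?_) hf
  rw [LinearMap.mulRight_apply, p_mul_X, ← hu, ← rank_one]
  exact p_mem_homogeneous _

theorem mul_Y_mem_homogeneous {n : ℕ} {f : R} (hf : f ∈ homogeneous n) :
    f * Y ∈ homogeneous (n + 2) := by
  refine homogeneous_le_comap (F := LinearMap.mulRight ℚ Y) (fun u hu => ?_) hf
  rw [LinearMap.mulRight_apply, p_mul_Y, ← hu]
  refine Submodule.smul_mem _ _ (Submodule.sub_mem _ ?_ ?_)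
  · have h := p_mem_homogeneous (.one :: .one :: u)
    rwa [rank_one, rank_one] at h
  · rw [← rank_two]; exact p_mem_homogeneous _

/-- The lowering operator, for which `s_v ↦ ∑_{u ↗ v} s_u`. -/
noncomputable def lower : R →ₗ[ℚ] R := pBasis.constr ℚ fun u => match u with
  | [] => 0
  | .one :: u => (((exponents u).1 + 1 : ℕ) : ℚ) • p u
  | .two :: _ => 0

theorem lower_p_nil : lower (p []) = 0 := by
  rw [lower, ← pBasis_apply, Module.Basis.constr_basis]

theorem lower_p_one (u : Word) :
    lower (p (.one :: u)) = (((exponents u).1 + 1 : ℕ) : ℚ) • p u := by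
  rw [lower, ← pBasis_apply (.one :: u), Module.Basis.constr_basis]

theorem lower_p_two (u : Word) : lower (p (.two :: u)) = 0 := by
  rw [lower, ← pBasis_apply, Module.Basis.constr_basis]

theorem lower_p_mul_X (u : Word) : lower (p u) * X = ((exponents u).1 : ℚ) • p u := by
  rcases u with _ | ⟨_ | _, u⟩
  · simp [lower_p_nil, exponents]
  · rw [lower_p_one, smul_mul_assoc, p_mul_X]; simp [exponents]
  · simp [lower_p_two, exponents]

/-- On `p u` the operator acts like differentiation in the trailing power of `X`, whence a Leibniz
rule. -/
theorem lower_mul_X (f : R) : lower (f * X) = lower f * X + f := by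
  have h : lower ∘ₗ LinearMap.mulRight ℚ X = LinearMap.mulRight ℚ X ∘ₗ lower + LinearMap.id := by
    refine pBasis.ext fun u => ?_
    simp only [pBasis_apply, LinearMap.comp_apply, LinearMap.mulRight_apply, LinearMap.add_apply,
      LinearMap.id_apply, p_mul_X, lower_p_one, lower_p_mul_X]
    push_cast
    rw [add_smul, one_smul]
  exact LinearMap.congr_fun h f

/-- Expanding `p u * Y`, the `p (2u)` part is killed and the coefficient `k + 2` from `p (11u)`
cancels the denominator. -/
theorem lower_mul_Y (f : R) : lower (f * Y) = f * X := by
  have h : lower ∘ₗ LinearMap.mulRight ℚ Y = LinearMap.mulRight ℚ X := by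
    refine pBasis.ext fun u => ?_
    have hne : (((exponents u).1 + 2 : ℕ) : ℚ) ≠ 0 := by positivity
    simp only [pBasis_apply, LinearMap.comp_apply, LinearMap.mulRight_apply, p_mul_X, p_mul_Y,
      map_smul, map_sub, lower_p_one, lower_p_two, sub_zero, exponents]
    exact inv_smul_smul₀ hne _
  exact LinearMap.congr_fun h f

theorem lower_mem_homogeneous {n : ℕ} {f : R} (hf : f ∈ homogeneous (n + 1)) :
    lower f ∈ homogeneous n := by
  refine homogeneous_le_comap (fun u hu => ?_) hf
  rcases u with _ | ⟨_ | _, u⟩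
  · rw [lower_p_nil]; exact zero_mem _
  · rw [lower_p_one]
    rw [rank_one, add_left_inj] at hu
    exact Submodule.smul_mem _ _ (hu ▸ p_mem_homogeneous u)
  · rw [lower_p_two]; exact zero_mem _

theorem lower_s_nil : lower (s []) = 0 := by rw [s_nil, ← p_nil, lower_p_nil]

theorem lower_s_two (v : Word) : lower (s (.two :: v)) = s v * X := by
  rw [s_two, lower_mul_Y]

theorem lower_s_one (v : Word) : lower (s (.one :: v)) = s v := by
  induction v with
  | nil =>
    have h := lower_mul_X 1
    rwa [one_mul, ← s_nil, lower_s_nil, zero_mul, zero_add, ← s_singleton] at h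
  | cons a v ih =>
    cases a with
    | one => rw [s_one_one, map_sub, lower_mul_X, ih, lower_mul_Y]; abel
    | two => rw [s_one_two, map_sub, lower_mul_X, lower_s_two, lower_mul_Y]; abel

/-- One formula replacing the separate recursions for `11v` and `12v`; the orthogonality argument
can then treat a leading `1` uniformly. -/
theorem s_one (v : Word) : s (.one :: v) = s v * X - lower (s v) * Y := by
  rcases v with _ | ⟨_ | _, v⟩
  · rw [lower_s_nil, s_nil, s_singleton]; simp
  · rw [lower_s_one, s_one_one]
  · rw [lower_s_two, s_one_two]

theorem s_mem_homogeneous (v : Word) : s v ∈ homogeneous (rank v) := by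
  induction hn : rank v using Nat.strong_induction_on generalizing v with
  | _ n ih =>
    rcases v with _ | ⟨_ | _, v⟩
    · rw [← hn, s_nil, ← p_nil]; exact p_mem_homogeneous []
    · rw [rank_one] at hn
      subst hn
      have h := ih (rank v) (by omega) v rfl
      rw [s_one]
      refine Submodule.sub_mem _ (mul_X_mem_homogeneous h) ?_
      rcases hv : rank v with _ | k
      · rcases v with _ | ⟨_ | _, v⟩
        · rw [lower_s_nil, zero_mul]; exact zero_mem _
        · rw [rank_one] at hv; omega
        · rw [rank_two] at hv; omega
      · rw [hv] at h
        exact mul_Y_mem_homogeneous (lower_mem_homogeneous h)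
    · rw [rank_two] at hn
      subst hn
      rw [s_two]
      exact mul_Y_mem_homogeneous (ih (rank v) (by omega) v rfl)

theorem lower_s {n : ℕ} (v : Word) (hv : rank v = n + 1) [DecidablePred fun u => Covers u v] :
    lower (s v) = ∑ u ∈ (level n).filter (fun u => Covers u v), s u := by
  rcases v with _ | ⟨_ | _, v⟩
  · simp [rank] at hv
  · rw [rank_one, add_left_inj] at hv
    have h : (level n).filter (fun u => Covers u (.one :: v)) = {v} := by
      ext u
      simp only [Finset.mem_filter, mem_level, covers_one_right_iff, Finset.mem_singleton]
      constructor
      · exact And.right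
      · rintro rfl; exact ⟨hv, rfl⟩
    rw [h, Finset.sum_singleton, lower_s_one]
  · have h : (level n).filter (fun u => Covers u (.two :: v)) = successors v := by
      ext u
      rw [rank_two] at hv
      simp only [Finset.mem_filter, mem_level, covers_two_right_iff, mem_successors]
      constructor
      · exact And.right
      · intro h; exact ⟨by rw [h.rank_eq]; omega, h⟩
    rw [h, lower_s_two, s_mul_X]

/-! ### Counting paths -/

/-- The number of oriented paths of length `k` from `v` to `w`. -/
noncomputable def numPaths : ℕ → Word → Word → ℕ
  | 0, v, w => if v = w then 1 else 0
  | k + 1, v, w => ∑ x ∈ successors v, numPaths k x w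

/-- The oriented paths of length `k` from `v` to `w`. -/
def pathSet (k : ℕ) (v w : Word) : Set (List Word) :=
  {l | l.length = k ∧ (v :: l).IsChain Covers ∧
    (v :: l).getLast (List.cons_ne_nil v l) = w}

theorem pathSet_zero (v w : Word) : pathSet 0 v w = if v = w then {[]} else ∅ := by
  ext l
  split_ifs with h
  · constructor
    · rintro ⟨h1, -⟩; exact List.length_eq_zero_iff.1 h1
    · rintro rfl; simp [pathSet, h]
  · simp only [pathSet, Set.mem_ofPred_eq, Set.mem_empty_iff_false, iff_false]
    rintro ⟨h1, -, h2⟩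
    obtain rfl := List.length_eq_zero_iff.1 h1
    exact h (by simpa using h2)

theorem pathSet_succ (k : ℕ) (v w : Word) :
    pathSet (k + 1) v w = ⋃ x ∈ successors v, (x :: ·) '' pathSet k x w := by
  ext l
  simp only [Set.mem_iUnion, Set.mem_image, mem_successors]
  constructor
  · rcases l with _ | ⟨x, l⟩
    · rintro ⟨h, -⟩; simp at h
    · rintro ⟨h1, h2, h3⟩
      rw [List.isChain_cons_cons] at h2
      exact ⟨x, h2.1, l, ⟨by simpa using h1, h2.2, by simpa using h3⟩, rfl⟩
  · rintro ⟨x, hx, l, ⟨h1, h2, h3⟩, rfl⟩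
    exact ⟨by simp [h1], List.isChain_cons_cons.2 ⟨hx, h2⟩, by simpa using h3⟩

theorem finite_pathSet (k : ℕ) (v w : Word) : (pathSet k v w).Finite := by
  induction k generalizing v with
  | zero => rw [pathSet_zero]; split_ifs <;> simp
  | succ k ih =>
    rw [pathSet_succ]
    exact Set.Finite.biUnion (Finset.finite_toSet _) fun x _ => (ih x).image _

theorem ncard_pathSet (k : ℕ) (v w : Word) : (pathSet k v w).ncard = numPaths k v w := by
  induction k generalizing v with
  | zero => rw [pathSet_zero, numPaths]; split_ifs <;> simp
  | succ k ih =>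
    classical
    have h : pathSet (k + 1) v w = ((successors v).biUnion fun x =>
        (finite_pathSet k x w).toFinset.image (x :: ·) : Finset (List Word)) := by
      rw [pathSet_succ]; ext l; simp
    rw [h, Set.ncard_coe_finset, Finset.card_biUnion, numPaths]
    · refine Finset.sum_congr rfl fun x _ => ?_
      rw [Finset.card_image_of_injective _ (List.cons_injective), ← ih x,
        Set.ncard_eq_toFinset_card _ (finite_pathSet k x w)]
    · intro x _ y _ hxy
      rw [Function.onFun, Finset.disjoint_left]
      intro l hl hl'
      simp only [Finset.mem_image] at hl hl'
      obtain ⟨l1, -, rfl⟩ := hl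
      obtain ⟨l2, -, h2⟩ := hl'
      exact hxy (by simpa using (List.cons.inj h2).1.symm)

theorem rank_getLast (v : Word) (l : List Word) (h : (v :: l).IsChain Covers) :
    rank ((v :: l).getLast (List.cons_ne_nil v l)) = rank v + l.length := by
  induction l generalizing v with
  | nil => simp
  | cons x l ih =>
    rw [List.isChain_cons_cons] at h
    rw [List.getLast_cons (List.cons_ne_nil x l), ih x h.2, h.1.rank_eq, List.length_cons]
    omega

theorem dim_eq_numPaths {v w : Word} {k : ℕ} (h : rank w = rank v + k) :
    dim v w = numPaths k v w := by
  rw [← ncard_pathSet, dim]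
  congr 1
  ext l
  simp only [pathSet, Set.mem_ofPred_eq]
  constructor
  · rintro ⟨h1, rfl⟩
    exact ⟨by rw [rank_getLast v l h1] at h; omega, h1, rfl⟩
  · exact And.right

theorem dim_eq_zero {v w : Word} (h : rank w < rank v) : dim v w = 0 := by
  have : {l : List Word | (v :: l).IsChain Covers ∧
      (v :: l).getLast (List.cons_ne_nil v l) = w} = ∅ := by
    ext l
    simp only [Set.mem_ofPred_eq, Set.mem_empty_iff_false, iff_false]
    rintro ⟨h1, rfl⟩
    rw [rank_getLast v l h1] at h; omega
  rw [dim, this, Set.ncard_empty]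

/-! ### Unital functionals, harmonic functions and path counts -/

/-- The functional `ψ` descends to the quotient by `X = 1`, so `v ↦ ψ(s_v)` is harmonic. -/
def IsUnital (ψ : R →ₗ[ℚ] ℝ) : Prop := ∀ f, ψ (f * X) = ψ f

theorem IsUnital.isHarmonic {ψ : R →ₗ[ℚ] ℝ} (h : IsUnital ψ) : IsHarmonic fun v => ψ (s v) := by
  intro u
  rw [← map_sum, ← s_mul_X, h]

theorem IsHarmonic.eq_sum_numPaths {φ : Word → ℝ} (h : IsHarmonic φ) (k : ℕ) (v : Word) :
    φ v = ∑ w ∈ level (rank v + k), (numPaths k v w : ℝ) * φ w := by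
  induction k generalizing v with
  | zero =>
    rw [Finset.sum_eq_single v]
    · simp [numPaths]
    · intro w _ hw; simp [numPaths, hw.symm]
    · intro hv; exact absurd ((mem_level _ _).2 rfl) hv
  | succ k ih =>
    have h1 : ∀ x ∈ successors v, φ x =
        ∑ w ∈ level (rank v + (k + 1)), (numPaths k x w : ℝ) * φ w := by
      intro x hx
      rw [ih x, (((mem_successors _ _).1 hx)).rank_eq, add_assoc, add_comm 1 k]
    rw [h v, Finset.sum_congr rfl h1, Finset.sum_comm]
    refine Finset.sum_congr rfl fun w _ => ?_
    rw [numPaths, Nat.cast_sum, Finset.sum_mul]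

/-- Each application of `lower` takes one step down the graph. This turns the inner sum of a
contraction into a power of a linear operator. -/
theorem lower_iterate_s {n j : ℕ} (v : Word) (hv : rank v = n + j) :
    (lower^[j]) (s v) = ∑ u ∈ level n, (numPaths j u v : ℚ) • s u := by
  classical
  induction j generalizing n with
  | zero =>
    rw [Finset.sum_eq_single v]
    · simp [numPaths]
    · intro w _ hw; simp [numPaths, hw]
    · intro h; exact absurd ((mem_level _ _).2 hv) h
  | succ j ih =>
    rw [Function.iterate_succ_apply', ih (n := n + 1) (by omega), map_sum]
    have h : ∀ u ∈ level (n + 1), lower ((numPaths j u v : ℚ) • s u) =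
        ∑ x ∈ level n, if Covers x u then (numPaths j u v : ℚ) • s x else 0 := by
      intro u hu
      rw [map_smul, lower_s u ((mem_level _ _).1 hu), Finset.smul_sum, Finset.sum_filter]
    rw [Finset.sum_congr rfl h, Finset.sum_comm]
    refine Finset.sum_congr rfl fun x hx => ?_
    have hx' := (mem_level _ _).1 hx
    rw [← Finset.sum_filter, numPaths, Nat.cast_sum, Finset.sum_smul]
    refine Finset.sum_congr ?_ fun _ _ => rfl
    rw [successors, hx']

/-! ### The values `φ_w(p_u)` as a single product -/

/-- One more than the largest position `δ ≤ d` of a `2` in the word (`0` if there is none). -/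
def cutoff : Word → ℕ → ℕ
  | [], _ => 0
  | .one :: u, d => cutoff u d
  | .two :: u, d => if rank u + 1 ≤ d then rank u + 2 else cutoff u d

/-- The rank of the word without its leading `1`s. -/
def coreRank : Word → ℕ
  | [] => 0
  | .one :: u => coreRank u
  | .two :: u => rank u + 2

theorem coreRank_add (u : Word) : coreRank u + (exponents u).1 = rank u := by
  induction u with
  | nil => simp [coreRank, exponents, rank]
  | cons a u ih =>
    cases a with
    | one => rw [rank_one, coreRank, exponents]; simp; omega
    | two => simp [rank_two, coreRank, exponents]

theorem coreRank_le (u : Word) : coreRank u ≤ rank u := by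
  have := coreRank_add u; omega

theorem cutoff_le (u : Word) (d : ℕ) : cutoff u d ≤ coreRank u := by
  induction u with
  | nil => simp [cutoff]
  | cons a u ih =>
    cases a with
    | one => exact ih
    | two =>
      rw [cutoff, coreRank]
      have := coreRank_le u
      split_ifs <;> omega

/-- The highest `2` of `u` has position at most `rank u - 1`, so such a `d` lies at or above all of
them. -/
theorem cutoff_eq {u : Word} {d : ℕ} (h : rank u ≤ d + 1) : cutoff u d = coreRank u := by
  induction u with
  | nil => rfl
  | cons a u ih =>
    cases a with
    | one => rw [rank_one] at h; exact ih (by omega)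
    | two => rw [rank_two] at h; rw [cutoff, coreRank, if_pos (by omega)]

theorem mem_positions_bounds {d : ℕ} {v : Word} (h : d ∈ positions v) :
    1 ≤ d ∧ d + 1 ≤ rank v := by
  induction v with
  | nil => simp [positions] at h
  | cons a v ih =>
    cases a with
    | one => rw [positions] at h; rw [rank_one]; have := ih h; omega
    | two =>
      rw [positions, Finset.mem_insert] at h; rw [rank_two]
      rcases h with rfl | h
      · omega
      · have := ih h; omega

theorem rank_add_one_notMem (v : Word) : rank v + 1 ∉ positions v := fun h => by
  have := mem_positions_bounds h; omega

-- Each `d` lies in at most one block, that of the largest `δ ≤ d`; all other factors are `1`. This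
-- collapses the double product of `pValue` to one over `d`.
open Classical in
theorem prod_positions_eq (u : Word) (d : ℕ) :
    ∏ δ ∈ positions u, (if δ ≤ d ∧ ∀ δ' ∈ positions u, δ < δ' → d < δ' then
      1 - ((δ : ℝ) + 1) / d else 1) = 1 - (cutoff u d : ℝ) / d := by
  induction u with
  | nil => simp [positions, cutoff]
  | cons a u ih =>
    cases a with
    | one => exact ih
    | two =>
      rw [positions, Finset.prod_insert (rank_add_one_notMem u), cutoff]
      split_ifs with h1 h2 h2
      · rw [Finset.prod_eq_one]
        · push_cast; ring
        · intro δ hδ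
          rw [if_neg]
          rintro ⟨-, h⟩
          have := mem_positions_bounds hδ
          exact absurd (h _ (Finset.mem_insert_self _ _) (by omega)) (by omega)
      · exact absurd h1.1 h2
      · refine absurd ⟨h2, ?_⟩ h1
        intro δ' hδ' hlt
        rcases Finset.mem_insert.1 hδ' with rfl | h
        · omega
        · have := mem_positions_bounds h; omega
      · rw [one_mul, ← ih]
        refine Finset.prod_congr rfl fun δ hδ => ?_
        congr 1
        simp only [Finset.forall_mem_insert, eq_iff_iff]
        constructor
        · rintro ⟨h3, -, h4⟩; exact ⟨h3, h4⟩
        · rintro ⟨h3, h4⟩; exact ⟨h3, fun _ => by omega, h4⟩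

theorem InfWord.IsSummable.indicator {w : InfWord} (hw : w.IsSummable) :
    Summable (w.positions.indicator fun d : ℕ => (1 : ℝ) / d) :=
  summable_subtype_iff_indicator.1 hw

theorem InfWord.IsSummable.summable_norm {w : InfWord} (hw : w.IsSummable) {S : Set ℕ}
    (hS : S ⊆ w.positions) {c : ℕ → ℝ} {C : ℝ} (hc : ∀ d, |c d| ≤ C) :
    Summable fun d => ‖S.indicator (fun d : ℕ => -(c d / d)) d‖ := by
  refine Summable.of_nonneg_of_le (fun _ => norm_nonneg _) (fun d => ?_)
    (hw.indicator.mul_left C)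
  by_cases hd : d ∈ S
  · rw [Set.indicator_of_mem hd, Set.indicator_of_mem (hS hd), norm_neg, norm_div,
      Real.norm_eq_abs, Real.norm_natCast, mul_one_div]
    gcongr
    exact hc d
  · rw [Set.indicator_of_notMem hd, norm_zero]
    exact mul_nonneg ((abs_nonneg _).trans (hc 0))
      (Set.indicator_nonneg (fun _ _ => by positivity) _)

theorem mulIndicator_one_sub (S : Set ℕ) (c : ℕ → ℝ) :
    (S.mulIndicator fun d : ℕ => 1 - c d / d) =
      fun d => 1 + S.indicator (fun d : ℕ => -(c d / d)) d := by
  ext d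
  by_cases hd : d ∈ S <;> simp [hd, sub_eq_add_neg]

/-- A product over a set of positions converges when its factors differ from `1` by `O(1 / d)`. -/
theorem InfWord.IsSummable.multipliable {w : InfWord} (hw : w.IsSummable) {S : Set ℕ}
    (hS : S ⊆ w.positions) {c : ℕ → ℝ} {C : ℝ} (hc : ∀ d, |c d| ≤ C) :
    Multipliable (S.mulIndicator fun d : ℕ => 1 - c d / d) := by
  rw [mulIndicator_one_sub]
  exact multipliable_one_add_of_summable (hw.summable_norm hS hc)

theorem pValue_eq_tprod {w : InfWord} (hw : w.IsSummable) (u : Word) :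
    pValue w u = ∏' d, w.positions.mulIndicator (fun d : ℕ => 1 - (cutoff u d : ℝ) / d) d := by
  classical
  have h1 : ∀ δ ∈ positions u, Multipliable
      ({d : ℕ | d ∈ w.positions ∧ δ ≤ d ∧ ∀ δ' ∈ positions u, δ < δ' → d < δ'}.mulIndicator
        fun d : ℕ => 1 - ((δ : ℝ) + 1) / d) := fun δ _ =>
    hw.multipliable (fun d hd => hd.1) (c := fun _ => (δ : ℝ) + 1) (fun _ => le_refl _)
  have h2 : pValue w u = ∏ δ ∈ positions u, ∏' d,
      {d : ℕ | d ∈ w.positions ∧ δ ≤ d ∧ ∀ δ' ∈ positions u, δ < δ' → d < δ'}.mulIndicator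
        (fun d : ℕ => 1 - ((δ : ℝ) + 1) / d) d :=
    Finset.prod_congr rfl fun δ _ => tprod_subtype
      {d : ℕ | d ∈ w.positions ∧ δ ≤ d ∧ ∀ δ' ∈ positions u, δ < δ' → d < δ'}
      (fun d : ℕ => 1 - ((δ : ℝ) + 1) / d)
  rw [h2, ← Multipliable.tprod_finsetProd h1]
  congr 1; ext d
  by_cases hd : d ∈ w.positions
  · rw [Set.mulIndicator_of_mem hd, ← prod_positions_eq]
    refine Finset.prod_congr rfl fun δ _ => ?_
    simp only [Set.mulIndicator_apply, Set.mem_ofPred_eq, hd, true_and]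
  · rw [Set.mulIndicator_of_notMem hd]
    refine Finset.prod_eq_one fun δ _ => ?_
    rw [Set.mulIndicator_of_notMem]
    exact fun h => hd h.1

/-! ### Finite words as infinite words -/

/-- The infinite word `⋯ 1 1 1 v`. -/
def Word.pad (v : Word) : InfWord := fun i => v.reverse.getD i .one

theorem Word.pad_one (v : Word) : Word.pad (.one :: v) = Word.pad v := by
  ext i
  simp only [Word.pad, List.reverse_cons]
  rcases lt_trichotomy i v.reverse.length with h | h | h
  · rw [List.getD_append _ _ _ _ h]
  · subst h
    rw [List.getD_append_right _ _ _ _ le_rfl,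
      List.getD_eq_default (n := v.reverse.length) _ _ le_rfl]
    simp
  · rw [List.getD_eq_default _ _ (by simp at h ⊢; omega), List.getD_eq_default _ _ h.le]

theorem Word.pad_apply_of_lt {v : Word} {i : ℕ} (a : Letter) (h : i < v.length) :
    Word.pad (a :: v) i = Word.pad v i := by
  simp only [Word.pad, List.reverse_cons]
  rw [List.getD_append _ _ _ _ (by simpa using h)]

theorem Word.pad_apply_length (v : Word) (a : Letter) : Word.pad (a :: v) v.length = a := by
  simp only [Word.pad, List.reverse_cons]
  rw [List.getD_append_right _ _ _ _ (by simp)]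
  simp

theorem Word.pad_apply_of_ge {v : Word} {i : ℕ} (h : v.length ≤ i) : Word.pad v i = .one :=
  List.getD_eq_default _ _ (by simpa using h)

theorem Word.sum_pad (v : Word) :
    ∑ j ∈ Finset.range v.length, (Word.pad v j).val = rank v := by
  induction v with
  | nil => simp [rank]
  | cons a v ih =>
    rw [List.length_cons, Finset.sum_range_succ, Word.pad_apply_length,
      Finset.sum_congr rfl fun j hj => by
        rw [Word.pad_apply_of_lt a (Finset.mem_range.1 hj)], ih]
    simp [rank, add_comm]

theorem Word.positions_pad (v : Word) : (Word.pad v).positions = (positions v : Set ℕ) := by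
  induction v with
  | nil =>
    ext d
    simp only [InfWord.positions, positions, Finset.coe_empty, Set.mem_empty_iff_false, iff_false]
    rintro ⟨i, hi, -⟩
    rw [Word.pad_apply_of_ge (by simp)] at hi
    exact absurd hi (by simp)
  | cons a v ih =>
    cases a with
    | one => rw [Word.pad_one, ih, positions]
    | two =>
      have hsum : ∀ i ≤ v.length, ∑ j ∈ Finset.range i, (Word.pad (.two :: v) j).val =
          ∑ j ∈ Finset.range i, (Word.pad v j).val := fun i hi =>
        Finset.sum_congr rfl fun j hj => by
          rw [Word.pad_apply_of_lt _ (lt_of_lt_of_le (Finset.mem_range.1 hj) hi)]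
      rw [positions, Finset.coe_insert, ← ih]
      ext d
      simp only [Set.mem_insert_iff]
      constructor
      · rintro ⟨i, hi, rfl⟩
        rcases lt_trichotomy i v.length with h | h | h
        · right
          rw [Word.pad_apply_of_lt _ h] at hi
          exact ⟨i, hi, by rw [hsum i h.le]⟩
        · left
          rw [h, hsum _ le_rfl, Word.sum_pad]
        · rw [Word.pad_apply_of_ge (by simp; omega)] at hi
          exact absurd hi (by simp)
      · rintro (rfl | ⟨i, hi, rfl⟩)
        · exact ⟨v.length, Word.pad_apply_length _ _, by rw [hsum _ le_rfl, Word.sum_pad]⟩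
        · have h : i < v.length := by
            by_contra h
            rw [Word.pad_apply_of_ge (not_lt.1 h)] at hi
            exact absurd hi (by simp)
          exact ⟨i, by rw [Word.pad_apply_of_lt _ h, hi], by rw [hsum i h.le]⟩

theorem Word.isSummable_pad (v : Word) : (Word.pad v).IsSummable := by
  have : Finite (Word.pad v).positions := by
    rw [Word.positions_pad]; exact (positions v).finite_toSet
  exact Summable.of_finite

theorem Word.pValue_pad (v u : Word) :
    pValue (Word.pad v) u = ∏ d ∈ positions v, (1 - (cutoff u d : ℝ) / d) := by
  rw [pValue_eq_tprod (Word.isSummable_pad v), Word.positions_pad,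
    tprod_eq_prod (s := positions v)]
  · exact Finset.prod_congr rfl fun d hd => Set.mulIndicator_of_mem (Finset.mem_coe.2 hd) _
  · intro d hd; exact Set.mulIndicator_of_notMem (by simpa using hd) _

/-! ### The functional of a finite word and the Martin kernel -/

theorem isUnital_functional (w : InfWord) : IsUnital (functional w) := by
  have h : functional w ∘ₗ LinearMap.mulRight ℚ X = functional w := by
    refine pBasis.ext fun u => ?_
    simp only [pBasis_apply, LinearMap.comp_apply, LinearMap.mulRight_apply, p_mul_X, functional_p]
    rfl
  exact LinearMap.congr_fun h

theorem Word.pValue_pad_two (w u : Word) : pValue (Word.pad (.two :: w)) u =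
    (1 - (cutoff u (rank w + 1) : ℝ) / (rank w + 1)) * pValue (Word.pad w) u := by
  rw [Word.pValue_pad, Word.pValue_pad, positions, Finset.prod_insert (rank_add_one_notMem w)]
  push_cast; rfl

theorem Word.pValue_pad_of_rank_le {w u : Word} (h : rank w ≤ rank u + 1) :
    pValue (Word.pad w) (.two :: u) = pValue (Word.pad w) u := by
  rw [Word.pValue_pad, Word.pValue_pad]
  refine Finset.prod_congr rfl fun d hd => ?_
  have := mem_positions_bounds hd
  rw [cutoff, if_neg (by omega)]

theorem Word.pValue_pad_cons_one (w u : Word) :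
    pValue (Word.pad w) (.one :: u) = pValue (Word.pad w) u := rfl

/-- `p u * Y` is a multiple of `p (11u) - p (2u)`. All `2`s of `w` lie below position `n + 1`, where
the new `2` acts, so the two values agree. -/
theorem Word.functional_pad_mul_Y_eq_zero {n : ℕ} {w : Word} (h : rank w ≤ n + 1) {f : R}
    (hf : f ∈ homogeneous n) : functional (Word.pad w) (f * Y) = 0 := by
  refine homogeneous_induction (F := functional (Word.pad w) ∘ₗ LinearMap.mulRight ℚ Y) (G := 0)
    (fun u hu => ?_) hf
  simp only [LinearMap.comp_apply, LinearMap.mulRight_apply, p_mul_Y, map_smul, map_sub,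
    functional_p, LinearMap.zero_apply]
  rw [Word.pValue_pad_of_rank_le (by omega), Word.pValue_pad_cons_one, Word.pValue_pad_cons_one,
    sub_self, smul_zero]

/-- Only the factor at the new position `n + 1` distinguishes `p (11u)` from `p (2u)`. The
difference is `(n + 2 - coreRank u) / (n + 1) = (k + 2) / (n + 1)`, with `k` the number of leading
`1`s of `u`, and `k + 2` cancels. -/
theorem Word.functional_pad_two_mul_Y {n : ℕ} {w : Word} (h : rank w = n) {f : R}
    (hf : f ∈ homogeneous n) : ((n : ℚ) + 1) • functional (Word.pad (.two :: w)) (f * Y) =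
      functional (Word.pad w) f := by
  refine homogeneous_induction
    (F := ((n : ℚ) + 1) • (functional (Word.pad (.two :: w)) ∘ₗ LinearMap.mulRight ℚ Y))
    (G := functional (Word.pad w)) (fun u hu => ?_) hf
  simp only [LinearMap.smul_apply, LinearMap.comp_apply, LinearMap.mulRight_apply, p_mul_Y,
    map_smul, map_sub, functional_p, Word.pValue_pad_two, Word.pValue_pad_cons_one]
  rw [Word.pValue_pad_of_rank_le (by omega)]
  have h1 : cutoff u (rank w + 1) = coreRank u := cutoff_eq (by omega)
  have h2 : cutoff (.two :: u) (rank w + 1) = n + 2 := by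
    rw [cutoff, if_pos (by omega), hu]
  have h3 := coreRank_add u
  have h4 : (coreRank u : ℝ) = n - (exponents u).1 := by
    rw [eq_sub_iff_add_eq, ← hu, ← h3]; push_cast; rfl
  rw [h1, h2, h4, h]
  simp only [Rat.smul_def]
  push_cast
  have h5 : (n : ℝ) + 1 ≠ 0 := by positivity
  have h6 : ((exponents u).1 : ℝ) + 2 ≠ 0 := by positivity
  field_simp
  ring

/-- For `1u` the factor at position `n + 1` is `(k + 1) / (n + 1)`, the coefficient in `lower`; for
`2u` it is zero, as is `lower`. -/
theorem Word.functional_pad_two {n : ℕ} {w : Word} (h : rank w = n) {f : R}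
    (hf : f ∈ homogeneous (n + 1)) : ((n : ℚ) + 1) • functional (Word.pad (.two :: w)) f =
      functional (Word.pad w) (lower f) := by
  refine homogeneous_induction (F := ((n : ℚ) + 1) • functional (Word.pad (.two :: w)))
    (G := functional (Word.pad w) ∘ₗ lower) (fun u hu => ?_) hf
  have h5 : (n : ℝ) + 1 ≠ 0 := by positivity
  simp only [LinearMap.smul_apply, LinearMap.comp_apply, functional_p, Word.pValue_pad_two]
  rcases u with _ | ⟨_ | _, u⟩
  · simp [rank] at hu
  · rw [rank_one, add_left_inj] at hu
    rw [lower_p_one, map_smul, functional_p, Word.pValue_pad_cons_one, cutoff,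
      cutoff_eq (by omega)]
    have h4 : (coreRank u : ℝ) = n - (exponents u).1 := by
      rw [eq_sub_iff_add_eq, ← hu, ← coreRank_add u]; push_cast; rfl
    rw [h4, h]
    simp only [Rat.smul_def]
    push_cast
    field_simp
    ring
  · rw [rank_two] at hu
    rw [lower_p_two, map_zero, cutoff, if_pos (by omega), h]
    have : ((rank u + 2 : ℕ) : ℝ) = n + 1 := by exact_mod_cast hu
    rw [this, div_self h5, sub_self, zero_mul, smul_zero]

/-- Induction on `w`, by leading letters. If they agree, one strips them, the `Y` term for a leading
`1` vanishing by degree. For `w = 1⋯`, `v = 2⋯` the value vanishes by degree. For `w = 2⋯`, `v = 1⋯`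
the two terms of `s_one` give the same value and cancel. -/
theorem Word.functional_pad_s_eq_zero {v w : Word} (h : rank v = rank w) (hvw : v ≠ w) :
    functional (Word.pad w) (s v) = 0 := by
  induction w generalizing v with
  | nil =>
    rcases v with _ | ⟨_ | _, v⟩
    · exact absurd rfl hvw
    · rw [rank_one] at h; simp [rank] at h
    · rw [rank_two] at h; simp [rank] at h
  | cons a w ih =>
    cases a with
    | one =>
      rw [rank_one] at h
      rw [Word.pad_one]
      rcases v with _ | ⟨_ | _, v⟩
      · simp [rank] at h
      · rw [rank_one, add_left_inj] at h
        rw [s_one, map_sub, isUnital_functional, ih h (by simpa using hvw), zero_sub, neg_eq_zero]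
        rcases hv : rank v with _ | k
        · rcases v with _ | ⟨_ | _, v⟩
          · simp [lower_s_nil]
          · rw [rank_one] at hv; omega
          · rw [rank_two] at hv; omega
        · refine Word.functional_pad_mul_Y_eq_zero (n := k) (by omega)
            (lower_mem_homogeneous ?_)
          rw [← hv]; exact s_mem_homogeneous v
      · rw [rank_two] at h
        rw [s_two]
        exact Word.functional_pad_mul_Y_eq_zero (by omega) (s_mem_homogeneous v)
    | two =>
      rw [rank_two] at h
      have hn : ((rank w : ℚ) + 1) ≠ 0 := by positivity
      suffices h' : ((rank w : ℚ) + 1) • functional (Word.pad (.two :: w)) (s v) = 0 from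
        (smul_eq_zero.1 h').resolve_left hn
      rcases v with _ | ⟨_ | _, v⟩
      · simp [rank] at h
      · rw [rank_one] at h
        have hv : s v ∈ homogeneous (rank w + 1) := by
          have := s_mem_homogeneous v
          rwa [show rank v = rank w + 1 by omega] at this
        rw [s_one, map_sub, isUnital_functional, smul_sub, Word.functional_pad_two rfl hv,
          Word.functional_pad_two_mul_Y rfl (lower_mem_homogeneous hv), sub_self]
      · rw [rank_two, add_left_inj] at h
        rw [s_two, Word.functional_pad_two_mul_Y rfl (h ▸ s_mem_homogeneous v),
          ih h (by simpa using hvw)]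

theorem pValue_nil (w : InfWord) : pValue w [] = 1 := by simp [pValue, positions]

theorem phiWord_nil (w : InfWord) : phiWord w [] = 1 := by
  rw [phiWord, s_nil, ← p_nil, functional_p, pValue_nil]

/-- Expanding by harmonicity up to the level of `w`, orthogonality leaves the single term at `w`. -/
theorem Word.phiWord_pad_eq {v w : Word} {k : ℕ} (h : rank w = rank v + k) :
    phiWord (Word.pad w) v = numPaths k v w * phiWord (Word.pad w) w := by
  refine ((isUnital_functional (Word.pad w)).isHarmonic.eq_sum_numPaths k v).trans ?_
  rw [Finset.sum_eq_single w]
  · rfl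
  · intro x hx hxw
    rw [Word.functional_pad_s_eq_zero (by rw [(mem_level _ _).1 hx, h]) hxw, mul_zero]
  · intro hw; exact absurd ((mem_level _ _).2 h) hw

theorem Word.dim_nil_mul_phiWord_pad (w : Word) :
    (dim [] w : ℝ) * phiWord (Word.pad w) w = 1 := by
  have h : rank w = rank [] + rank w := by simp [rank]
  rw [dim_eq_numPaths h, ← Word.phiWord_pad_eq h, phiWord_nil]

/-- Normalization at the empty word gives this without exhibiting a path. -/
theorem Word.dim_nil_ne_zero (w : Word) : (dim [] w : ℝ) ≠ 0 :=
  left_ne_zero_of_mul_eq_one (Word.dim_nil_mul_phiWord_pad w)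

theorem martinKernel_eq_phiWord {v w : Word} (h : rank v ≤ rank w) :
    martinKernel v w = phiWord (Word.pad w) v := by
  obtain ⟨k, hk⟩ := Nat.exists_eq_add_of_le h
  rw [Word.phiWord_pad_eq hk, martinKernel, dim_eq_numPaths hk,
    eq_comm, eq_div_iff (Word.dim_nil_ne_zero w), mul_assoc, mul_comm (phiWord _ _),
    Word.dim_nil_mul_phiWord_pad, mul_one]

/-! ### Contractions -/

/-- Iteration strips leading `1`s with coefficients `k, k - 1, …`, and a unital functional does not
see the stripping. -/
theorem IsUnital.apply_lower_iterate {ψ : R →ₗ[ℚ] ℝ} (hψ : IsUnital ψ) (j : ℕ) (u : Word) :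
    ψ ((lower^[j]) (p u)) = ((exponents u).1.descFactorial j : ℝ) * ψ (p u) := by
  induction j generalizing u with
  | zero => simp
  | succ j ih =>
    rw [Function.iterate_succ_apply]
    have hzero : (lower^[j]) (0 : R) = 0 := by
      clear ih
      induction j with
      | zero => rfl
      | succ j ih => rw [Function.iterate_succ_apply, map_zero, ih]
    rcases u with _ | ⟨_ | _, u⟩
    · rw [lower_p_nil, hzero]; simp [exponents]
    · rw [lower_p_one, ← Module.End.pow_apply, map_smul, map_smul, Module.End.pow_apply, ih,
        exponents, Nat.succ_descFactorial_succ, p_one, hψ, Rat.smul_def]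
      push_cast; ring
    · rw [lower_p_two, hzero]; simp [exponents]

/-- The functional on `R` extending the contraction of `v ↦ ψ(s_v)`. -/
noncomputable def contractionFunctional (τ : ℝ) (ψ : R →ₗ[ℚ] ℝ) : R →ₗ[ℚ] ℝ :=
  pBasis.constr ℚ fun u => τ ^ coreRank u * ψ (p u)

theorem contractionFunctional_p (τ : ℝ) (ψ : R →ₗ[ℚ] ℝ) (u : Word) :
    contractionFunctional τ ψ (p u) = τ ^ coreRank u * ψ (p u) := by
  rw [contractionFunctional, ← pBasis_apply u, Module.Basis.constr_basis, pBasis_apply]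

/-- A falling factorial over a factorial is a binomial coefficient; the sum is `τ ^ (n - m)` times
the expansion of `((1 - τ) + τ) ^ m`. -/
theorem sum_contraction_weights (τ : ℝ) {m n : ℕ} (h : m ≤ n) :
    ∑ k ∈ Finset.range (n + 1), τ ^ k * (1 - τ) ^ (n - k) / ((n - k).factorial : ℝ) *
      (m.descFactorial (n - k) : ℝ) = τ ^ (n - m) := by
  rw [← Finset.sum_range_reflect]
  have h1 : ∀ j ∈ Finset.range (n + 1), τ ^ (n + 1 - 1 - j) * (1 - τ) ^ (n - (n + 1 - 1 - j)) /
      ((n - (n + 1 - 1 - j)).factorial : ℝ) * (m.descFactorial (n - (n + 1 - 1 - j)) : ℝ) =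
      τ ^ (n - j) * (1 - τ) ^ j * (m.choose j : ℝ) := by
    intro j hj
    have hj' := Finset.mem_range.1 hj
    rw [show n + 1 - 1 - j = n - j by omega, show n - (n - j) = j by omega,
      Nat.descFactorial_eq_factorial_mul_choose]
    have : (j.factorial : ℝ) ≠ 0 := by positivity
    push_cast
    field_simp
  rw [Finset.sum_congr rfl h1, ← Finset.sum_subset (Finset.range_mono (Nat.succ_le_succ h))]
  · have h2 : ∀ j ∈ Finset.range (m + 1), τ ^ (n - j) * (1 - τ) ^ j * (m.choose j : ℝ) =
        τ ^ (n - m) * ((1 - τ) ^ j * τ ^ (m - j) * (m.choose j : ℝ)) := by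
      intro j hj
      have hj' := Finset.mem_range.1 hj
      rw [show n - j = (n - m) + (m - j) by omega, pow_add]; ring
    rw [Finset.sum_congr rfl h2, ← Finset.mul_sum, ← add_pow]
    simp
  · intro j _ hj
    rw [Nat.choose_eq_zero_of_lt (by simpa using hj)]; simp

theorem contraction_eq {ψ : R →ₗ[ℚ] ℝ} (hψ : IsUnital ψ) (τ : ℝ) (v : Word) :
    contraction τ (fun u => ψ (s u)) v = contractionFunctional τ ψ (s v) := by
  have h1 : ∀ k ∈ Finset.range (rank v + 1), ∑ u ∈ level k, ψ (s u) * (dim u v : ℝ) =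
      ψ ((lower ^ (rank v - k)) (s v)) := by
    intro k hk
    have hk' := Finset.mem_range.1 hk
    rw [Module.End.pow_apply, lower_iterate_s (n := k) v (by omega), map_sum]
    refine Finset.sum_congr rfl fun u hu => ?_
    have hu' := (mem_level _ _).1 hu
    rw [map_smul, dim_eq_numPaths (k := rank v - k) (by omega), Rat.smul_def, mul_comm]
    simp
  rw [contraction, Finset.sum_congr rfl fun k hk => by rw [h1 k hk]]
  -- Writing each summand as a linear functional allows the identity to be checked on the `p u` of
  -- rank `rank v`, where the contraction is diagonal.
  let T : ℕ → R →ₗ[ℚ] ℝ := fun k =>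
    LinearMap.restrictScalars ℚ (LinearMap.mulLeft ℝ
      (τ ^ k * (1 - τ) ^ (rank v - k) / ((rank v - k).factorial : ℝ))) ∘ₗ ψ ∘ₗ
        lower ^ (rank v - k)
  have h2 := homogeneous_induction (F := ∑ k ∈ Finset.range (rank v + 1), T k)
    (G := contractionFunctional τ ψ) (n := rank v) (fun u hu => ?_) (s_mem_homogeneous v)
  · rw [← h2, LinearMap.sum_apply]; rfl
  · have h3 := coreRank_add u
    rw [LinearMap.sum_apply, contractionFunctional_p, show coreRank u = rank v - (exponents u).1
      by omega, ← sum_contraction_weights τ (m := (exponents u).1) (n := rank v) (by omega),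
      Finset.sum_mul]
    refine Finset.sum_congr rfl fun k _ => ?_
    simp only [T, LinearMap.comp_apply, LinearMap.restrictScalars_apply, LinearMap.mulLeft_apply]
    rw [Module.End.pow_apply, hψ.apply_lower_iterate, mul_assoc]

/-- At `τ = 0` only the term `k = 0` survives, so `P` can be treated as a contraction with `β = 0`.
-/
theorem plancherel_eq {φ : Word → ℝ} (hφ : φ [] = 1) (v : Word) :
    plancherel v = contraction 0 φ v := by
  rw [contraction, Finset.sum_eq_single 0]
  · simp [level, hφ, plancherel, div_eq_inv_mul]
  · intro k _ hk; simp [hk]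
  · simp

/-! ### The functionals attached to the points of the parameter space -/

namespace Omega

/-- The value of `φ_ω` at `p_u`. -/
noncomputable def value : Omega → Word → ℝ
  | P, u => 0 ^ coreRank u
  | pair β w _ _ _, u => β ^ coreRank u * pValue w u

/-- The linear functional on `R` extending `φ_ω`. -/
noncomputable def toFunctional (ω : Omega) : R →ₗ[ℚ] ℝ := pBasis.constr ℚ ω.value

theorem toFunctional_p (ω : Omega) (u : Word) : ω.toFunctional (p u) = ω.value u := by
  rw [toFunctional, ← pBasis_apply, Module.Basis.constr_basis]

theorem phi_eq (ω : Omega) (v : Word) : ω.phi v = ω.toFunctional (s v) := by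
  cases ω with
  | P =>
    have hc : contractionFunctional 0 (functional (Word.pad [])) = toFunctional P := by
      refine pBasis.ext fun u => ?_
      rw [pBasis_apply, contractionFunctional_p, toFunctional_p, functional_p, value,
        Word.pValue_pad]
      simp [positions]
    rw [phi, plancherel_eq (phiWord_nil (Word.pad [])), ← hc]
    exact contraction_eq (isUnital_functional _) 0 v
  | pair β w h1 h2 h3 =>
    have hc : contractionFunctional β (functional w) = toFunctional (pair β w h1 h2 h3) := by
      refine pBasis.ext fun u => ?_
      rw [pBasis_apply, contractionFunctional_p, toFunctional_p, functional_p, value]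
    rw [← hc]
    exact contraction_eq (isUnital_functional w) β v

theorem value_one (ω : Omega) (u : Word) : ω.value (.one :: u) = ω.value u := by
  cases ω <;> rfl

theorem isUnital_toFunctional (ω : Omega) : IsUnital ω.toFunctional := by
  have h : ω.toFunctional ∘ₗ LinearMap.mulRight ℚ X = ω.toFunctional := by
    refine pBasis.ext fun u => ?_
    simp only [pBasis_apply, LinearMap.comp_apply, LinearMap.mulRight_apply, p_mul_X,
      toFunctional_p, value_one]
  exact LinearMap.congr_fun h

theorem isHarmonic_phi (ω : Omega) : IsHarmonic ω.phi := by
  rw [show ω.phi = fun v => ω.toFunctional (s v) from funext ω.phi_eq]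
  exact ω.isUnital_toFunctional.isHarmonic

theorem phi_nil (ω : Omega) : ω.phi [] = 1 := by
  rw [phi_eq, s_nil, ← p_nil, toFunctional_p]
  cases ω <;> simp [value, coreRank, pValue_nil]

/-- The point `(1, ⋯ 1 1 w)`. -/
noncomputable def ofWord (w : Word) : Omega :=
  pair 1 (Word.pad w) one_pos le_rfl (Word.isSummable_pad w)

theorem phi_ofWord {v w : Word} (h : rank v ≤ rank w) : (ofWord w).phi v = martinKernel v w := by
  rw [martinKernel_eq_phiWord h, phi_eq, phiWord]
  congr 1
  refine pBasis.ext fun u => ?_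
  rw [pBasis_apply, toFunctional_p, functional_p, ofWord, value, one_pow, one_mul]

end Omega

/-- The span contains `1` and is stable under right multiplication by `X` and `Y`, hence contains
every `p u`. So a function `φ_ω` determines its functional. -/
theorem span_s : Submodule.span ℚ (Set.range s) = ⊤ := by
  have hX : ∀ f ∈ Submodule.span ℚ (Set.range s), f * X ∈ Submodule.span ℚ (Set.range s) := by
    intro f hf
    have : Submodule.span ℚ (Set.range s) ≤
        (Submodule.span ℚ (Set.range s)).comap (LinearMap.mulRight ℚ X) := by
      rw [Submodule.span_le]
      rintro _ ⟨v, rfl⟩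
      rw [SetLike.mem_coe, Submodule.mem_comap, LinearMap.mulRight_apply, s_mul_X]
      exact Submodule.sum_mem _ fun w _ => Submodule.subset_span ⟨w, rfl⟩
    exact this hf
  have hY : ∀ f ∈ Submodule.span ℚ (Set.range s), f * Y ∈ Submodule.span ℚ (Set.range s) := by
    intro f hf
    have : Submodule.span ℚ (Set.range s) ≤
        (Submodule.span ℚ (Set.range s)).comap (LinearMap.mulRight ℚ Y) := by
      rw [Submodule.span_le]
      rintro _ ⟨v, rfl⟩
      rw [SetLike.mem_coe, Submodule.mem_comap, LinearMap.mulRight_apply, ← s_two]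
      exact Submodule.subset_span ⟨_, rfl⟩
    exact this hf
  have hp : ∀ u, p u ∈ Submodule.span ℚ (Set.range s) := by
    intro u
    induction u with
    | nil => rw [p_nil, ← s_nil]; exact Submodule.subset_span ⟨_, rfl⟩
    | cons a u ih =>
      cases a with
      | one => rw [p_one]; exact hX _ ih
      | two =>
        rw [p_two]
        exact Submodule.sub_mem _ (hX _ (hX _ ih)) (Submodule.smul_mem _ _ (hY _ ih))
  rw [eq_top_iff, ← pBasis.span_eq, Submodule.span_le]
  rintro _ ⟨u, rfl⟩
  rw [pBasis_apply]
  exact hp u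

theorem Omega.value_eq_of_phi_eq {ω ω' : Omega} (h : ω.phi = ω'.phi) : ω.value = ω'.value := by
  have h1 : ω.toFunctional = ω'.toFunctional := by
    refine LinearMap.ext_on span_s ?_
    rintro _ ⟨v, rfl⟩
    rw [← Omega.phi_eq, ← Omega.phi_eq, h]
  ext u
  rw [← Omega.toFunctional_p, h1, Omega.toFunctional_p]

/-! ### The space of infinite words -/

instance : TopologicalSpace Letter := ⊥

instance : DiscreteTopology Letter := ⟨rfl⟩

instance : Finite Letter :=
  Finite.of_injective (fun a : Letter => decide (a = .one)) fun a b => by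
    cases a <;> cases b <;> simp

namespace InfWord

/-- The rank of the last `i` letters of an infinite word. -/
def prefixRank (w : InfWord) (i : ℕ) : ℕ := ∑ j ∈ Finset.range i, (w j).val

theorem prefixRank_succ (w : InfWord) (i : ℕ) :
    w.prefixRank (i + 1) = w.prefixRank i + (w i).val := Finset.sum_range_succ _ _

theorem strictMono_prefixRank (w : InfWord) : StrictMono w.prefixRank :=
  strictMono_nat_of_lt_succ fun i => by
    rw [prefixRank_succ]; cases w i <;> simp [Letter.val]

theorem mem_positions_iff (w : InfWord) (d : ℕ) :
    d ∈ w.positions ↔ ∃ i, w i = .two ∧ d = w.prefixRank i + 1 := Iff.rfl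

theorem prefixRank_mem_positions_iff (w : InfWord) (i : ℕ) :
    w.prefixRank i + 1 ∈ w.positions ↔ w i = .two := by
  rw [mem_positions_iff]
  constructor
  · rintro ⟨j, hj, h⟩
    rwa [w.strictMono_prefixRank.injective (Nat.succ_injective h)]
  · intro h; exact ⟨i, h, rfl⟩

theorem zero_notMem_positions (w : InfWord) : 0 ∉ w.positions := by
  rintro ⟨i, -, h⟩; omega

theorem succ_notMem_positions {w : InfWord} {d : ℕ} (h : d ∈ w.positions) :
    d + 1 ∉ w.positions := by
  obtain ⟨i, hi, rfl⟩ := h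
  rintro ⟨j, -, hj⟩
  change w.prefixRank i + 1 + 1 = w.prefixRank j + 1 at hj
  have h1 : i < j := w.strictMono_prefixRank.lt_iff_lt.1 (by omega)
  have h2 := w.strictMono_prefixRank.monotone (Nat.succ_le_of_lt h1)
  rw [Nat.succ_eq_add_one, prefixRank_succ, hi, Letter.val] at h2
  omega

theorem eq_of_positions_eq {w w' : InfWord} (h : w.positions = w'.positions) : w = w' := by
  ext i
  induction i using Nat.strong_induction_on with
  | _ i ih =>
    have h1 : w.prefixRank i = w'.prefixRank i :=
      Finset.sum_congr rfl fun j hj => by rw [ih j (Finset.mem_range.1 hj)]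
    have h2 := w.prefixRank_mem_positions_iff i
    rw [h, h1, w'.prefixRank_mem_positions_iff i] at h2
    cases hw : w i <;> cases hw' : w' i <;> simp_all

theorem continuous_prefixRank (i : ℕ) : Continuous fun w : InfWord => w.prefixRank i :=
  continuous_finsetSum _ fun j _ =>
    (continuous_of_discreteTopology (f := Letter.val)).comp (continuous_apply j)

/-- Letters have rank at least one, so only the last `d` letters decide whether `d` is a position.
-/
theorem isClopen_mem_positions (d : ℕ) : IsClopen {w : InfWord | d ∈ w.positions} := by
  have h : {w : InfWord | d ∈ w.positions} =
      ⋃ i ∈ Finset.range d, {w : InfWord | (w i, w.prefixRank i) = (Letter.two, d - 1)} := by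
    ext w
    simp only [Set.mem_ofPred_eq, Set.mem_iUnion, Finset.mem_range, Prod.mk.injEq,
      mem_positions_iff, exists_prop]
    constructor
    · rintro ⟨i, hi, rfl⟩
      exact ⟨i, Nat.lt_succ_of_le w.strictMono_prefixRank.le_apply, hi, by omega⟩
    · rintro ⟨i, hid, hi, h⟩
      exact ⟨i, hi, by omega⟩
  rw [h]
  refine (Finset.range d).finite_toSet.isClopen_biUnion fun i _ => ?_
  exact (isClopen_discrete {(Letter.two, d - 1)}).preimage
    ((continuous_apply i).prodMk (continuous_prefixRank i))

theorem continuous_mulIndicator (f : ℕ → ℝ) (d : ℕ) :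
    Continuous fun w : InfWord => w.positions.mulIndicator f d := by
  classical
  have h : (fun w : InfWord => w.positions.mulIndicator f d) =
      fun w : InfWord => if w ∈ {w : InfWord | d ∈ w.positions} then f d else 1 := by
    ext w; rw [Set.mulIndicator_apply]; rfl
  rw [h]
  exact Continuous.if (fun a ha => by
    rw [show {w : InfWord | w ∈ {w : InfWord | d ∈ w.positions}} =
      {w : InfWord | d ∈ w.positions} from rfl, (isClopen_mem_positions d).frontier_eq] at ha
    exact ha.elim) continuous_const continuous_const

/-! ### The product `π(w)` -/

/-- The factor `1 - 1 / d` of `π(w)`. -/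
noncomputable def piFactor (d : ℕ) : ℝ := if 2 ≤ d then 1 - 1 / (d : ℝ) else 1

theorem half_le_piFactor (d : ℕ) : 1 / 2 ≤ piFactor d := by
  rw [piFactor]
  split_ifs with h
  · have : (2 : ℝ) ≤ d := by exact_mod_cast h
    have := one_div_le_one_div_of_le two_pos this
    linarith
  · norm_num

theorem piFactor_pos (d : ℕ) : 0 < piFactor d := by linarith [half_le_piFactor d]

theorem piFactor_le_one (d : ℕ) : piFactor d ≤ 1 := by
  rw [piFactor]
  split_ifs
  · have : 0 ≤ 1 / (d : ℝ) := by positivity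
    linarith
  · exact le_rfl

theorem mulIndicator_piFactor_pos (w : InfWord) (d : ℕ) :
    0 < w.positions.mulIndicator piFactor d := by
  classical
  rw [Set.mulIndicator_apply]; split_ifs
  · exact piFactor_pos d
  · exact one_pos

theorem mulIndicator_piFactor_le_one (w : InfWord) (d : ℕ) :
    w.positions.mulIndicator piFactor d ≤ 1 := by
  classical
  rw [Set.mulIndicator_apply]; split_ifs
  · exact piFactor_le_one d
  · exact le_rfl

theorem pi_eq_tprod (w : InfWord) : w.pi = ∏' d, w.positions.mulIndicator piFactor d := by
  have h : w.pi = ∏' d, {d : ℕ | d ∈ w.positions ∧ 2 ≤ d}.mulIndicator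
      (fun d : ℕ => 1 - 1 / (d : ℝ)) d := tprod_subtype
    {d : ℕ | d ∈ w.positions ∧ 2 ≤ d} (fun d : ℕ => 1 - 1 / (d : ℝ))
  rw [h]
  congr 1; ext d
  classical
  simp only [Set.mulIndicator_apply, Set.mem_ofPred_eq, piFactor]
  by_cases h1 : d ∈ w.positions <;> by_cases h2 : 2 ≤ d <;> simp [h1, h2]

theorem piFactor_eq (d : ℕ) : piFactor d = 1 - (if 2 ≤ d then 1 else 0 : ℝ) / d := by
  rw [piFactor]; split_ifs <;> simp

theorem IsSummable.multipliable_piFactor {w : InfWord} (hw : w.IsSummable) :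
    Multipliable (w.positions.mulIndicator piFactor) := by
  rw [show piFactor = fun d : ℕ => 1 - (if 2 ≤ d then 1 else 0 : ℝ) / d from funext piFactor_eq]
  refine hw.multipliable subset_rfl (C := 1) fun d => ?_
  split_ifs <;> simp

theorem IsSummable.hasProd_pi {w : InfWord} (hw : w.IsSummable) :
    HasProd (w.positions.mulIndicator piFactor) w.pi := by
  rw [pi_eq_tprod]; exact hw.multipliable_piFactor.hasProd

/-- A convergent product over positions does not vanish when no factor does. -/
theorem IsSummable.tprod_ne_zero {w : InfWord} (hw : w.IsSummable) {c : ℕ → ℝ} {C : ℝ}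
    (hc : ∀ d, |c d| ≤ C) (h0 : ∀ d ∈ w.positions, 1 - c d / d ≠ 0) :
    ∏' d, w.positions.mulIndicator (fun d : ℕ => 1 - c d / d) d ≠ 0 := by
  rw [mulIndicator_one_sub]
  refine tprod_one_add_ne_zero_of_summable (fun d => ?_) (hw.summable_norm subset_rfl hc)
  by_cases hd : d ∈ w.positions
  · have := h0 d hd
    simpa [hd, sub_eq_add_neg] using this
  · simp [hd]

theorem IsSummable.pi_le_prod {w : InfWord} (hw : w.IsSummable) (t : Finset ℕ) :
    w.pi ≤ ∏ d ∈ t, w.positions.mulIndicator piFactor d := by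
  classical
  refine le_of_tendsto hw.hasProd_pi ?_
  filter_upwards [eventually_ge_atTop t] with s' hs
  rw [← Finset.prod_sdiff hs]
  refine mul_le_of_le_one_left (Finset.prod_nonneg fun d _ => (mulIndicator_piFactor_pos w d).le) ?_
  exact Finset.prod_le_one (fun d _ => (mulIndicator_piFactor_pos w d).le)
    fun d _ => mulIndicator_piFactor_le_one w d

theorem IsSummable.pi_le_one {w : InfWord} (hw : w.IsSummable) : w.pi ≤ 1 := by
  simpa using hw.pi_le_prod ∅

theorem IsSummable.pi_pos {w : InfWord} (hw : w.IsSummable) : 0 < w.pi := by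
  refine lt_of_le_of_ne ?_ (Ne.symm ?_)
  · exact ge_of_tendsto' hw.hasProd_pi fun t =>
      Finset.prod_nonneg fun d _ => (mulIndicator_piFactor_pos w d).le
  · rw [pi_eq_tprod,
      show piFactor = fun d : ℕ => 1 - (if 2 ≤ d then 1 else 0 : ℝ) / d from funext piFactor_eq]
    refine hw.tprod_ne_zero (C := 1) (fun d => ?_) (fun d _ => ?_)
    · split_ifs <;> simp
    · rw [← piFactor_eq]; exact (piFactor_pos d).ne'

/-- A word is summable once the partial products of `π` are bounded below. -/
theorem isSummable_of_le_prod {w : InfWord} {c : ℝ} (hc : 0 < c)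
    (h : ∀ M, c ≤ ∏ d ∈ Finset.range M, w.positions.mulIndicator piFactor d) :
    w.IsSummable ∧ c ≤ w.pi := by
  have hs : w.IsSummable := by
    refine (summable_subtype_iff_indicator (f := fun d : ℕ => (1 : ℝ) / d)).2 ?_
    refine summable_of_sum_range_le (c := 1 - Real.log c)
      (fun d => Set.indicator_nonneg (fun _ _ => by positivity) _) fun M => ?_
    -- This is `1 - 1/d ≤ exp (-1/d)`. Position `1` contributes to the sum but not to `π`; the term
    -- for `d = 1` compensates and explains the `1` in the bound `1 - log c`.
    have h1 : ∀ d : ℕ, w.positions.mulIndicator piFactor d ≤ Real.exp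
        ((if d = 1 then 1 else 0) - w.positions.indicator (fun d : ℕ => (1 : ℝ) / d) d) := by
      intro d
      by_cases hd : d ∈ w.positions
      · rw [Set.mulIndicator_of_mem hd, Set.indicator_of_mem hd]
        rcases lt_or_ge d 2 with h2 | h2
        · rw [piFactor, if_neg (by omega)]
          have h3 : d ≠ 0 := fun h => w.zero_notMem_positions (h ▸ hd)
          obtain rfl : d = 1 := by omega
          simp
        · rw [piFactor, if_pos h2, if_neg (by omega)]
          have := Real.add_one_le_exp (0 - 1 / (d : ℝ))
          linarith
      · rw [Set.mulIndicator_of_notMem hd, Set.indicator_of_notMem hd]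
        apply Real.one_le_exp
        split_ifs <;> simp
    have h2 : c ≤ Real.exp (1 - ∑ d ∈ Finset.range M,
        w.positions.indicator (fun d : ℕ => (1 : ℝ) / d) d) := by
      refine (h M).trans ((Finset.prod_le_prod (fun d _ => (mulIndicator_piFactor_pos w d).le)
        fun d _ => h1 d).trans ?_)
      rw [← Real.exp_sum, Finset.sum_sub_distrib]
      gcongr
      rw [Finset.sum_ite_eq']
      split_ifs <;> simp
    have h3 := (Real.log_le_iff_le_exp hc).2 h2
    linarith
  refine ⟨hs, ge_of_tendsto' hs.hasProd_pi.tendsto_prod_nat h⟩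

/-! ### The ratio of `φ_w(p_u)` and a power of `π(w)` -/

/-- The factor of `φ_w(p_u)` at `d`, divided by the corresponding factor of `π(w)` to the power
`coreRank u`. -/
noncomputable def ratioFactor (u : Word) (d : ℕ) : ℝ :=
  (1 - (cutoff u d : ℝ) / d) / piFactor d ^ coreRank u

/-- The product of the `ratioFactor`s over the positions of an infinite word. -/
noncomputable def ratio (u : Word) (w : InfWord) : ℝ :=
  ∏' d, w.positions.mulIndicator (ratioFactor u) d

/-- Bernoulli's inequality on one side, induction on the other. The absence of a first-order term is
what gives convergence beyond summable words. -/
theorem abs_one_sub_pow_sub_le (N : ℕ) {x : ℝ} (h0 : 0 ≤ x) (h1 : x ≤ 1) :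
    |(1 - N * x) - (1 - x) ^ N| ≤ N ^ 2 * x ^ 2 := by
  have hl : 1 - N * x ≤ (1 - x) ^ N := by
    have := one_add_mul_le_pow (a := -x) (by linarith) N
    calc 1 - N * x = 1 + N * -x := by ring
      _ ≤ (1 + -x) ^ N := this
      _ = (1 - x) ^ N := by ring
  have hu : (1 - x) ^ N ≤ 1 - N * x + N ^ 2 * x ^ 2 := by
    clear hl
    induction N with
    | zero => simp
    | succ N ih =>
      have h2 : (1 - x) ^ (N + 1) ≤ (1 - N * x + N ^ 2 * x ^ 2) * (1 - x) := by
        rw [pow_succ]; exact mul_le_mul_of_nonneg_right ih (by linarith)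
      refine h2.trans ?_
      push_cast
      have h3 : 0 ≤ (N : ℝ) ^ 2 * x ^ 3 := by positivity
      have h4 : 0 ≤ ((N : ℝ) + 1) * x ^ 2 := by positivity
      nlinarith
  rw [abs_le]
  constructor <;> nlinarith [sq_nonneg x]

/-- Here the cutoff equals `coreRank u`, so the first-order terms of numerator and denominator
cancel; `2 ^ coreRank u` comes from `piFactor d ≥ 1/2`. -/
theorem abs_ratioFactor_sub_one_le {u : Word} {d : ℕ} (h : rank u ≤ d + 1) (hd : 2 ≤ d) :
    |ratioFactor u d - 1| ≤ (coreRank u : ℝ) ^ 2 * 2 ^ coreRank u * (1 / (d : ℝ) ^ 2) := by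
  set N := coreRank u
  have hd' : (2 : ℝ) ≤ d := by exact_mod_cast hd
  have hx1 : 1 / (d : ℝ) ≤ 1 := by rw [div_le_one (by linarith)]; linarith
  have hp : (1 / 2 : ℝ) ^ N ≤ piFactor d ^ N :=
    pow_le_pow_left₀ (by norm_num) (half_le_piFactor d) N
  have hp0 : 0 < piFactor d ^ N := pow_pos (piFactor_pos d) N
  have h1 := abs_one_sub_pow_sub_le N (x := 1 / (d : ℝ)) (by positivity) hx1
  have h2 : ratioFactor u d - 1 =
      ((1 - N * (1 / (d : ℝ))) - (1 - 1 / (d : ℝ)) ^ N) / piFactor d ^ N := by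
    have h3 : (1 - 1 / (d : ℝ)) = piFactor d := by rw [piFactor, if_pos hd]
    rw [h3, ratioFactor, cutoff_eq h, mul_one_div, eq_div_iff hp0.ne', sub_mul,
      div_mul_cancel₀ _ hp0.ne', one_mul]
  rw [h2, abs_div, abs_of_pos hp0, div_le_iff₀ hp0]
  refine h1.trans ?_
  have h4 : (2 : ℝ) ^ N * (1 / 2) ^ N = 1 := by rw [← mul_pow]; norm_num
  calc (N : ℝ) ^ 2 * (1 / (d : ℝ)) ^ 2
      = (N : ℝ) ^ 2 * (2 ^ N * (1 / 2) ^ N) * (1 / (d : ℝ) ^ 2) := by rw [h4, div_pow]; ring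
    _ = (N : ℝ) ^ 2 * 2 ^ N * (1 / (d : ℝ) ^ 2) * (1 / 2) ^ N := by ring
    _ ≤ _ := mul_le_mul_of_nonneg_left hp (by positivity)

theorem summable_ratio_bound (C : ℝ) : Summable fun d : ℕ => C * (1 / (d : ℝ) ^ 2) :=
  (Real.summable_one_div_nat_pow.2 one_lt_two).mul_left C

theorem mulIndicator_ratioFactor_eq (u : Word) (w : InfWord) (d : ℕ) :
    w.positions.mulIndicator (ratioFactor u) d =
      1 + (w.positions.mulIndicator (ratioFactor u) d - 1) := by ring

theorem abs_mulIndicator_ratioFactor_le (u : Word) : ∀ᶠ d in atTop, ∀ w : InfWord,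
    ‖w.positions.mulIndicator (ratioFactor u) d - 1‖ ≤
      (coreRank u : ℝ) ^ 2 * 2 ^ coreRank u * (1 / (d : ℝ) ^ 2) := by
  filter_upwards [eventually_ge_atTop (max (rank u) 2)] with d hd w
  have h1 := (le_max_left _ _).trans hd
  have h2 := (le_max_right _ _).trans hd
  by_cases hw : d ∈ w.positions
  · rw [Set.mulIndicator_of_mem hw]; exact abs_ratioFactor_sub_one_le (by omega) h2
  · rw [Set.mulIndicator_of_notMem hw, sub_self, norm_zero]; positivity

theorem multipliable_ratioFactor (u : Word) (w : InfWord) :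
    Multipliable (w.positions.mulIndicator (ratioFactor u)) := by
  rw [show w.positions.mulIndicator (ratioFactor u) = fun d =>
    1 + (w.positions.mulIndicator (ratioFactor u) d - 1) from
      funext (mulIndicator_ratioFactor_eq u w)]
  refine multipliable_one_add_of_summable ?_
  refine Summable.of_norm_bounded_eventually_nat
    (summable_ratio_bound ((coreRank u : ℝ) ^ 2 * 2 ^ coreRank u)) ?_
  filter_upwards [abs_mulIndicator_ratioFactor_le u] with d hd
  rw [norm_norm]; exact hd w

/-- The `O(1/d²)` bound is uniform in the word, so the product converges uniformly, and each finite
partial product is continuous. Summability of the word plays no role. -/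
theorem continuous_ratio (u : Word) : Continuous (ratio u) := by
  have h := Summable.hasProdUniformlyOn_nat_one_add (K := (Set.univ : Set InfWord))
    (f := fun d w => w.positions.mulIndicator (ratioFactor u) d - 1) isCompact_univ
    (summable_ratio_bound ((coreRank u : ℝ) ^ 2 * 2 ^ coreRank u))
    ((abs_mulIndicator_ratioFactor_le u).mono fun d hd w _ => hd w)
    (fun d => ((continuous_mulIndicator _ d).sub continuous_const).continuousOn)
  simp only [← mulIndicator_ratioFactor_eq] at h
  rw [hasProdUniformlyOn_iff_tendstoUniformlyOn] at h
  rw [← continuousOn_univ]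
  refine h.continuousOn (Frequently.of_forall fun t => ?_)
  exact (continuous_finsetProd _ fun d _ => continuous_mulIndicator _ d).continuousOn

theorem exists_ratio_bound (u : Word) : ∃ C, ∀ w, |ratio u w| ≤ C := by
  obtain ⟨C, hC⟩ := isCompact_univ.exists_bound_of_continuousOn (continuous_ratio u).continuousOn
  exact ⟨C, fun w => hC w (Set.mem_univ w)⟩

/-- This isolates the power of `π(w)`, the only part that need not be continuous for digitwise
convergence. -/
theorem IsSummable.pValue_eq {w : InfWord} (hw : w.IsSummable) (u : Word) :
    pValue w u = w.pi ^ coreRank u * ratio u w := by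
  rw [pValue_eq_tprod hw, pi_eq_tprod, ratio]
  have h := (hw.hasProd_pi.pow (coreRank u)).mul (multipliable_ratioFactor u w).hasProd
  rw [pi_eq_tprod] at h
  rw [← ratio] at h ⊢
  rw [← h.tprod_eq]
  congr 1; ext d
  by_cases hd : d ∈ w.positions
  · rw [Set.mulIndicator_of_mem hd, Set.mulIndicator_of_mem hd, Set.mulIndicator_of_mem hd,
      ratioFactor, mul_div_cancel₀ _ (pow_pos (piFactor_pos d) _).ne']
  · rw [Set.mulIndicator_of_notMem hd, Set.mulIndicator_of_notMem hd,
      Set.mulIndicator_of_notMem hd, one_pow, one_mul]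

end InfWord

theorem positions_eq_empty {u : Word} (h : coreRank u = 0) : positions u = ∅ := by
  induction u with
  | nil => rfl
  | cons a u ih =>
    cases a with
    | one => exact ih h
    | two => rw [coreRank] at h; omega

namespace Omega

/-! ### Continuity of `ω ↦ φ_ω` -/

/-- The infinite word of a point of `Ω` (an arbitrary one for the point `P`). -/
def word : Omega → InfWord
  | P => fun _ => .one
  | pair _ w _ _ _ => w

theorem word_apply_of_hasLetter {ω : Omega} {i : ℕ} {a : Letter} (h : ω.HasLetter i a) :
    ω.word i = a := by
  cases ω with
  | P => exact h.elim
  | pair β w h1 h2 h3 => exact h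

theorem weight_nonneg (ω : Omega) : 0 ≤ ω.weight := by
  cases ω with
  | P => exact le_rfl
  | pair β w h1 h2 h3 => exact mul_nonneg h1.le h3.pi_pos.le

theorem weight_le_one (ω : Omega) : ω.weight ≤ 1 := by
  cases ω with
  | P => exact zero_le_one
  | pair β w h1 h2 h3 => exact mul_le_one₀ h2 h3.pi_pos.le h3.pi_le_one

theorem value_of_coreRank_eq_zero (ω : Omega) {u : Word} (h : coreRank u = 0) :
    ω.value u = 1 := by
  cases ω with
  | P => simp [value, h]
  | pair β w h1 h2 h3 => simp [value, h, pValue, positions_eq_empty h]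

/-- At `P` a positive power of the weight is `0`, so the arbitrary choice of word there is harmless.
-/
theorem value_eq (ω : Omega) {u : Word} (h : coreRank u ≠ 0) :
    ω.value u = ω.weight ^ coreRank u * InfWord.ratio u ω.word := by
  cases ω with
  | P => simp [value, weight, h]
  | pair β w h1 h2 h3 => rw [value, weight, word, h3.pValue_eq, mul_pow, mul_assoc]

/-- Near `P` the words are uncontrolled and boundedness of the ratio suffices; elsewhere its
continuity is used. -/
theorem Converges.value {x : ℕ → Omega} {ω : Omega} (h : Converges x ω) (u : Word) :
    Tendsto (fun n => (x n).value u) atTop (𝓝 (ω.value u)) := by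
  by_cases hu : coreRank u = 0
  · simp only [value_of_coreRank_eq_zero _ hu]; exact tendsto_const_nhds
  · simp only [value_eq _ hu]
    cases ω with
    | P =>
      obtain ⟨C, hC⟩ := InfWord.exists_ratio_bound u
      have h1 : Tendsto (fun n => (x n).weight ^ coreRank u) atTop (𝓝 0) := by
        have := Tendsto.pow (show Tendsto (fun n => (x n).weight) atTop (𝓝 0) from h) (coreRank u)
        rwa [zero_pow hu] at this
      rw [weight, zero_pow hu, zero_mul]
      exact h1.zero_mul_isBoundedUnder_le (isBoundedUnder_of ⟨C, fun n => hC _⟩)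
    | pair β w h1 h2 h3 =>
      refine (Tendsto.pow h.2 _).mul ?_
      refine ((InfWord.continuous_ratio u).tendsto w).comp (tendsto_pi_nhds.2 fun i => ?_)
      exact tendsto_nhds_of_eventually_eq ((h.1 i).mono fun n hn => word_apply_of_hasLetter hn)

theorem toFunctional_eq_sum (ω : Omega) (r : R) :
    ω.toFunctional r = (pBasis.repr r).sum fun u c => (c : ℝ) * ω.value u := by
  rw [toFunctional, Module.Basis.constr_apply]
  simp only [Rat.smul_def]

theorem Converges.phi {x : ℕ → Omega} {ω : Omega} (h : Converges x ω) :
    Tendsto (fun n => (x n).phi) atTop (𝓝 ω.phi) := by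
  refine tendsto_pi_nhds.2 fun v => ?_
  simp only [phi_eq, toFunctional_eq_sum, Finsupp.sum]
  exact tendsto_finsetSum _ fun u _ => (h.value u).const_mul _

theorem continuous_of_converges {Z : Type*} [TopologicalSpace Z] {f : Omega → Z}
    (h : ∀ x ω, Converges x ω → Tendsto (fun n => f (x n)) atTop (𝓝 (f ω))) : Continuous f :=
  ⟨fun _ hV ω hω x hx => (h x ω hx).eventually (hV.mem_nhds hω)⟩

theorem continuous_phi : Continuous phi := continuous_of_converges fun _ _ h => h.phi

/-! ### Injectivity of `ω ↦ φ_ω` -/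

/-- The word `2 1^k`. -/
def hook (k : ℕ) : Word := .two :: List.replicate k .one

theorem rank_replicate_one (k : ℕ) : rank (List.replicate k .one) = k := by
  simp [rank, Letter.val]

theorem cutoff_replicate_one (k d : ℕ) : cutoff (List.replicate k .one) d = 0 := by
  induction k with
  | zero => rfl
  | succ k ih => exact ih

theorem coreRank_hook (k : ℕ) : coreRank (hook k) = k + 2 := by
  rw [hook, coreRank, rank_replicate_one]

theorem cutoff_hook (k d : ℕ) : cutoff (hook k) d = if k + 1 ≤ d then k + 2 else 0 := by
  rw [hook, cutoff, rank_replicate_one, cutoff_replicate_one]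

/-- A convergent product vanishes only through a factor, and `1 - (k + 2) / d` vanishes only at `d =
k + 2`. -/
theorem pValue_hook_eq_zero_iff {w : InfWord} (hw : w.IsSummable) (k : ℕ) :
    pValue w (hook k) = 0 ↔ k + 2 ∈ w.positions := by
  rw [pValue_eq_tprod hw]
  constructor
  · contrapose!
    intro h
    refine hw.tprod_ne_zero (c := fun d => (cutoff (hook k) d : ℝ)) (C := (k + 2 : ℕ))
      (fun d => ?_) (fun d hd => ?_)
    · rw [Nat.abs_cast, ← coreRank_hook]; exact_mod_cast cutoff_le _ _
    · have hd0 : d ≠ 0 := fun h => w.zero_notMem_positions (h ▸ hd)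
      have hd0' : (d : ℝ) ≠ 0 := by exact_mod_cast hd0
      have hd1 : d ≠ k + 2 := fun h' => h (h' ▸ hd)
      rw [sub_ne_zero, cutoff_hook, Ne, eq_div_iff hd0', one_mul]
      split_ifs
      · exact_mod_cast hd1
      · exact_mod_cast hd0
  · intro h
    refine tprod_of_exists_eq_zero ⟨k + 2, ?_⟩
    have h1 : ((k + 2 : ℕ) : ℝ) ≠ 0 := by positivity
    rw [Set.mulIndicator_of_mem h, cutoff_hook, if_pos (by omega), div_self h1, sub_self]

/-- Position `1` contributes the factor `-1`, and all other factors are nonnegative. If `1` is a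
position then `2` is not, so the product is not zero. -/
theorem pValue_hook_zero_neg_iff {w : InfWord} (hw : w.IsSummable) :
    pValue w (hook 0) < 0 ↔ 1 ∈ w.positions := by
  classical
  have hm : HasProd (w.positions.mulIndicator fun d : ℕ => 1 - (cutoff (hook 0) d : ℝ) / d)
      (pValue w (hook 0)) := by
    rw [pValue_eq_tprod hw]
    refine (hw.multipliable subset_rfl (C := (2 : ℕ)) fun d => ?_).hasProd
    rw [Nat.abs_cast]; exact_mod_cast (cutoff_le _ _).trans (coreRank_hook 0).le
  have hnonneg : ∀ d ≠ 1,
      0 ≤ w.positions.mulIndicator (fun d : ℕ => 1 - (cutoff (hook 0) d : ℝ) / d) d := by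
    intro d hd1
    by_cases hd : d ∈ w.positions
    · have hd0 : d ≠ 0 := fun h => w.zero_notMem_positions (h ▸ hd)
      have hd2 : (2 : ℝ) ≤ d := by exact_mod_cast (show 2 ≤ d by omega)
      rw [Set.mulIndicator_of_mem hd, cutoff_hook, if_pos (by omega), sub_nonneg,
        div_le_one (by linarith)]
      simpa using hd2
    · rw [Set.mulIndicator_of_notMem hd]; exact zero_le_one
  constructor
  · contrapose!
    intro h1
    refine ge_of_tendsto' hm fun t => Finset.prod_nonneg fun d _ => ?_
    by_cases hd : d = 1
    · rw [hd, Set.mulIndicator_of_notMem h1]; exact zero_le_one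
    · exact hnonneg d hd
  · intro h1
    refine lt_of_le_of_ne ?_ ?_
    · refine le_of_tendsto hm ?_
      filter_upwards [eventually_ge_atTop {1}] with t ht
      rw [← Finset.mul_prod_erase t _ (Finset.singleton_subset_iff.1 ht)]
      refine mul_nonpos_of_nonpos_of_nonneg ?_ (Finset.prod_nonneg fun d hd =>
        hnonneg d (Finset.ne_of_mem_erase hd))
      rw [Set.mulIndicator_of_mem h1, cutoff_hook]; norm_num
    · rw [Ne, pValue_hook_eq_zero_iff hw]
      exact InfWord.succ_notMem_positions h1

theorem exists_pValue_hook_ne_zero {w : InfWord} (hw : w.IsSummable) :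
    ∃ k, pValue w (hook k) ≠ 0 := by
  by_cases h : 2 ∈ w.positions
  · exact ⟨1, by rw [Ne, pValue_hook_eq_zero_iff hw]; exact InfWord.succ_notMem_positions h⟩
  · exact ⟨0, by rwa [Ne, pValue_hook_eq_zero_iff hw]⟩

theorem value_P_ne {β : ℝ} {w : InfWord} (h1 : 0 < β) (h2 : β ≤ 1) (h3 : w.IsSummable) :
    P.value ≠ (pair β w h1 h2 h3).value := by
  intro h
  obtain ⟨k, hk⟩ := exists_pValue_hook_ne_zero h3
  have := congrFun h (hook k)
  rw [value, value, coreRank_hook, zero_pow (by omega)] at this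
  exact mul_ne_zero (pow_pos h1 _).ne' hk this.symm

/-- Positivity of `β` preserves signs and zeros at the hooks, so these determine all positions. A
hook with nonzero value then determines a power of `β`. -/
theorem value_injective : Function.Injective value := by
  intro ω ω' h
  cases ω with
  | P =>
    cases ω' with
    | P => rfl
    | pair β w h1 h2 h3 => exact absurd h (value_P_ne h1 h2 h3)
  | pair β w h1 h2 h3 =>
    cases ω' with
    | P => exact absurd h.symm (value_P_ne h1 h2 h3)
    | pair β' w' h1' h2' h3' =>
      have hv : ∀ k, β ^ (k + 2) * pValue w (hook k) = β' ^ (k + 2) * pValue w' (hook k) := by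
        intro k
        have := congrFun h (hook k)
        rwa [value, value, coreRank_hook] at this
      have hneg : ∀ {a b : ℝ}, 0 < a → (a * b < 0 ↔ b < 0) := fun ha =>
        ⟨fun h => neg_of_mul_neg_right h ha.le, mul_neg_of_pos_of_neg ha⟩
      have hpos : w.positions = w'.positions := by
        ext d
        rcases d with _ | _ | k
        · exact iff_of_false w.zero_notMem_positions w'.zero_notMem_positions
        · rw [zero_add, ← pValue_hook_zero_neg_iff h3, ← pValue_hook_zero_neg_iff h3',
            ← hneg (pow_pos h1 (0 + 2)), hv,
            hneg (pow_pos h1' (0 + 2))]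
        · rw [add_assoc, ← pValue_hook_eq_zero_iff h3, ← pValue_hook_eq_zero_iff h3',
            ← mul_eq_zero_iff_left (pow_pos h1 (k + 2)).ne', hv,
            mul_eq_zero_iff_left (pow_pos h1' (k + 2)).ne']
      obtain rfl := InfWord.eq_of_positions_eq hpos
      obtain ⟨k, hk⟩ := exists_pValue_hook_ne_zero h3
      have hβ := mul_right_cancel₀ hk (hv k)
      obtain rfl : β = β' := (pow_left_inj₀ h1.le h1'.le (by omega)).1 hβ
      rfl

theorem phi_injective : Function.Injective phi := fun _ _ h =>
  value_injective (value_eq_of_phi_eq h)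

/-! ### Sequential compactness of `Ω` -/

theorem weight_le_prod (ω : Omega) (M : ℕ) :
    ω.weight ≤ ∏ d ∈ Finset.range M, ω.word.positions.mulIndicator InfWord.piFactor d := by
  cases ω with
  | P => exact Finset.prod_nonneg fun d _ => (InfWord.mulIndicator_piFactor_pos _ d).le
  | pair β w h1 h2 h3 =>
    exact (mul_le_of_le_one_left h3.pi_pos.le h2).trans (h3.pi_le_prod _)

theorem hasLetter_word {ω : Omega} (h : 0 < ω.weight) (i : ℕ) : ω.HasLetter i (ω.word i) := by
  cases ω with
  | P => exact absurd h (lt_irrefl 0)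
  | pair β w h1 h2 h3 => rfl

theorem exists_converges_subseq (x : ℕ → Omega) :
    ∃ (ω : Omega) (ψ : ℕ → ℕ), StrictMono ψ ∧ Converges (x ∘ ψ) ω := by
  have hK : IsCompact (Set.Icc (0 : ℝ) 1 ×ˢ (Set.univ : Set InfWord)) :=
    isCompact_Icc.prod isCompact_univ
  obtain ⟨⟨c, w⟩, hcw, ψ, hψ, hlim⟩ := hK.tendsto_subseq
    (x := fun n => ((x n).weight, (x n).word))
    fun n => ⟨⟨(x n).weight_nonneg, (x n).weight_le_one⟩, Set.mem_univ _⟩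
  rw [Prod.tendsto_iff] at hlim
  obtain ⟨hc, hw⟩ := hlim
  simp only [Function.comp_def] at hc hw
  rcases hcw.1.1.eq_or_lt with h0 | h0
  · refine ⟨P, ψ, hψ, ?_⟩
    simp only at h0
    rw [← h0] at hc
    exact hc
  · simp only at h0
    have h1 : ∀ M, c ≤ ∏ d ∈ Finset.range M, w.positions.mulIndicator InfWord.piFactor d := by
      intro M
      have hcont : Continuous fun w : InfWord =>
          ∏ d ∈ Finset.range M, w.positions.mulIndicator InfWord.piFactor d :=
        continuous_finsetProd _ fun d _ => InfWord.continuous_mulIndicator _ d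
      exact le_of_tendsto_of_tendsto' hc ((hcont.tendsto w).comp hw) fun n =>
        weight_le_prod _ M
    obtain ⟨hs, hle⟩ := InfWord.isSummable_of_le_prod h0 h1
    -- The weight may drop in the limit even if `π` does not converge; `β = c / π(w)` absorbs the
    -- loss and is at most `1` because `c ≤ π(w)`.
    refine ⟨pair (c / w.pi) w (div_pos h0 hs.pi_pos) ((div_le_one hs.pi_pos).2 hle) hs, ψ, hψ,
      fun i => ?_, ?_⟩
    · have h2 : ∀ᶠ n in atTop, (x (ψ n)).word i = w i :=
        ((tendsto_pi_nhds.1 hw i).eventually (isOpen_discrete {w i} |>.mem_nhds rfl)).mono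
          fun n hn => hn
      filter_upwards [h2, hc.eventually (lt_mem_nhds h0)] with n hn hpos
      rw [← hn]
      exact hasLetter_word hpos i
    · rw [div_mul_cancel₀ _ hs.pi_pos.ne']
      exact hc

/-! ### Density of the finite words -/

theorem pi_pad (v : Word) : (Word.pad v).pi = ∏ d ∈ positions v, InfWord.piFactor d := by
  rw [InfWord.pi_eq_tprod, Word.positions_pad, tprod_eq_prod (s := positions v)]
  · exact Finset.prod_congr rfl fun d hd => Set.mulIndicator_of_mem (Finset.mem_coe.2 hd) _
  · intro d hd; exact Set.mulIndicator_of_notMem (by simpa using hd) _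

theorem pi_pad_two {v : Word} (h : 1 ≤ rank v) :
    (Word.pad (.two :: v)).pi = (1 - 1 / ((rank v : ℝ) + 1)) * (Word.pad v).pi := by
  rw [pi_pad, pi_pad, positions, Finset.prod_insert (rank_add_one_notMem v), InfWord.piFactor,
    if_pos (by omega)]
  push_cast; rfl

theorem rank_replicate_two_append (k : ℕ) (v : Word) :
    rank (List.replicate k .two ++ v) = rank v + 2 * k := by
  simp [rank, Letter.val]; omega

/-- From rank `m`, a new `2` multiplies `π` by `m / (m + 1)` and raises the rank to `m + 2`. Since
`m (m + 2) ≤ (m + 1)²`, the quantity `π² · rank` does not increase. -/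
theorem pi_pad_replicate_two_le {v : Word} (h : 1 ≤ rank v) (k : ℕ) :
    (Word.pad (List.replicate k .two ++ v)).pi ^ 2 * ((rank v : ℝ) + 2 * k) ≤ rank v := by
  induction k with
  | zero =>
    have h1 := (Word.isSummable_pad v).pi_le_one
    have h2 := (Word.isSummable_pad v).pi_pos
    have h3 : (Word.pad v).pi ^ 2 ≤ 1 := pow_le_one₀ h2.le h1
    simpa using mul_le_mul_of_nonneg_right h3 (Nat.cast_nonneg (rank v))
  | succ k ih =>
    rw [List.replicate_succ, List.cons_append,
      pi_pad_two (by rw [rank_replicate_two_append]; omega), rank_replicate_two_append]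
    refine le_trans ?_ ih
    have hr : (1 : ℝ) ≤ rank v := by exact_mod_cast h
    push_cast
    set m : ℝ := (rank v : ℝ) + 2 * k with hm
    have hm0 : 0 < m := by positivity
    set q := (Word.pad (List.replicate k .two ++ v)).pi
    have h1 : (1 - 1 / (m + 1)) ^ 2 * (m + 2) ≤ m := by
      have : (1 - 1 / (m + 1)) = m / (m + 1) := by field_simp; ring
      rw [this, div_pow, div_mul_eq_mul_div, div_le_iff₀ (by positivity)]
      nlinarith
    calc ((1 - 1 / (m + 1)) * q) ^ 2 * ((rank v : ℝ) + 2 * (k + 1))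
        = q ^ 2 * ((1 - 1 / (m + 1)) ^ 2 * (m + 2)) := by rw [hm]; ring
      _ ≤ q ^ 2 * m := mul_le_mul_of_nonneg_left h1 (sq_nonneg q)

theorem tendsto_pi_pad_replicate_two {v : Word} (h : 1 ≤ rank v) :
    Tendsto (fun k => (Word.pad (List.replicate k .two ++ v)).pi) atTop (𝓝 0) := by
  have h1 : Tendsto (fun k : ℕ => (rank v : ℝ) / ((rank v : ℝ) + 2 * k)) atTop (𝓝 0) := by
    refine Tendsto.div_atTop tendsto_const_nhds ?_
    exact tendsto_atTop_add_const_left _ _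
      (tendsto_natCast_atTop_atTop.const_mul_atTop two_pos)
  have h2 : Tendsto (fun k => (Word.pad (List.replicate k .two ++ v)).pi ^ 2) atTop (𝓝 0) := by
    refine squeeze_zero (fun k => sq_nonneg _) (fun k => ?_) h1
    have hr : (1 : ℝ) ≤ rank v := by exact_mod_cast h
    rw [le_div_iff₀ (by positivity)]
    exact pi_pad_replicate_two_le h k
  have h3 := h2.sqrt
  rw [Real.sqrt_zero] at h3
  refine h3.congr fun k => Real.sqrt_sq (Word.isSummable_pad _).pi_pos.le

/-- The last `n` letters of an infinite word. -/
def suffix (w : InfWord) : ℕ → Word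
  | 0 => []
  | n + 1 => w n :: suffix w n

theorem length_suffix (w : InfWord) (n : ℕ) : (suffix w n).length = n := by
  induction n with
  | zero => rfl
  | succ n ih => rw [suffix, List.length_cons, ih]

theorem length_le_rank (v : Word) : v.length ≤ rank v := by
  induction v with
  | nil => exact le_rfl
  | cons a v ih => cases a <;> simp only [rank_one, rank_two, List.length_cons] <;> omega

theorem pad_suffix_apply {w : InfWord} {n i : ℕ} (h : i < n) : Word.pad (suffix w n) i = w i := by
  induction n with
  | zero => omega
  | succ n ih =>
    rw [suffix]
    rcases Nat.lt_succ_iff_lt_or_eq.1 h with h | rfl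
    · rw [Word.pad_apply_of_lt _ (by rwa [length_suffix]), ih h]
    · have := Word.pad_apply_length (suffix w i) (w i)
      rwa [length_suffix] at this

theorem positions_suffix_subset (w : InfWord) (n : ℕ) :
    (positions (suffix w n) : Set ℕ) ⊆ w.positions := by
  rw [← Word.positions_pad]
  rintro _ ⟨i, hi, rfl⟩
  have hin : i < n := by
    by_contra h
    rw [Word.pad_apply_of_ge (by rw [length_suffix]; omega)] at hi
    exact absurd hi (by simp)
  rw [pad_suffix_apply hin] at hi
  refine ⟨i, hi, ?_⟩
  congr 1
  exact Finset.sum_congr rfl fun j hj => by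
    rw [pad_suffix_apply ((Finset.mem_range.1 hj).trans hin)]

theorem pi_le_pi_pad_suffix {w : InfWord} (hw : w.IsSummable) (n : ℕ) :
    w.pi ≤ (Word.pad (suffix w n)).pi := by
  refine (hw.pi_le_prod (positions (suffix w n))).trans_eq ?_
  rw [pi_pad]
  exact Finset.prod_congr rfl fun d hd =>
    Set.mulIndicator_of_mem (positions_suffix_subset w n (Finset.mem_coe.2 hd)) _

theorem pad_replicate_two_append_apply {v : Word} {i : ℕ} (h : i < v.length) (k : ℕ) :
    Word.pad (List.replicate k .two ++ v) i = Word.pad v i := by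
  induction k with
  | zero => rfl
  | succ k ih =>
    rw [List.replicate_succ, List.cons_append, Word.pad_apply_of_lt _ (by simp; omega), ih]

/-- Keep the last `n` letters, where `π` is still at least `c`, and prepend `2`s until it first
drops to `c` or below. One step loses a factor no smaller than `1 - 1/(n + 1)`, which bounds the
overshoot. -/
theorem exists_approximating_word {w : InfWord} (hw : w.IsSummable) {c : ℝ} (h0 : 0 < c)
    (hc : c ≤ w.pi) (n : ℕ) : ∃ y : Word, n ≤ rank y ∧ (∀ i < n, Word.pad y i = w i) ∧
      c * (1 - 1 / ((n : ℝ) + 1)) ≤ (Word.pad y).pi ∧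
      (Word.pad y).pi ≤ c + 1 / ((n : ℝ) + 1) := by
  rcases Nat.eq_zero_or_pos n with rfl | hn
  · refine ⟨[], by simp, by simp, ?_, ?_⟩
    · simpa using (Word.isSummable_pad []).pi_pos.le
    · have := (Word.isSummable_pad []).pi_le_one
      simp only [Nat.cast_zero, zero_add, div_one]
      linarith
  set v := suffix w n
  have hv : n ≤ rank v := (length_suffix w n).symm.le.trans (length_le_rank v)
  have hn0 : 0 < 1 / ((n : ℝ) + 1) := by positivity
  have hex : ∃ k, (Word.pad (List.replicate k .two ++ v)).pi ≤ c :=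
    (((tendsto_pi_pad_replicate_two (hn.trans_le hv)).eventually (gt_mem_nhds h0)).exists).imp
      fun k hk => hk.le
  classical
  have hspec := Nat.find_spec hex
  refine ⟨List.replicate (Nat.find hex) .two ++ v, ?_, ?_, ?_, hspec.trans (by linarith)⟩
  · rw [rank_replicate_two_append]; omega
  · intro i hi
    rw [pad_replicate_two_append_apply (by rwa [length_suffix]), pad_suffix_apply hi]
  · rcases hk : Nat.find hex with _ | k
    · refine le_trans ?_ (hc.trans (pi_le_pi_pad_suffix hw n))
      nlinarith
    · have hlt := not_le.1 (Nat.find_min hex (show k < Nat.find hex by omega))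
      have hr := rank_replicate_two_append k v
      rw [List.replicate_succ, List.cons_append, pi_pad_two (by omega), mul_comm]
      have h1 : 1 / ((rank (List.replicate k .two ++ v) : ℝ) + 1) ≤ 1 / ((n : ℝ) + 1) := by
        have : (n : ℝ) ≤ rank (List.replicate k .two ++ v) := by
          exact_mod_cast (show n ≤ rank (List.replicate k .two ++ v) by omega)
        gcongr
      have h2 : 1 / ((n : ℝ) + 1) ≤ 1 := by
        rw [div_le_one (by positivity)]
        have : (0 : ℝ) ≤ n := Nat.cast_nonneg n
        linarith
      exact mul_le_mul (by linarith) hlt.le h0.le (by linarith)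

theorem exists_converges_ofWord (ω : Omega) : ∃ y : ℕ → Word,
    Tendsto (fun n => rank (y n)) atTop atTop ∧ Converges (fun n => ofWord (y n)) ω := by
  cases ω with
  | P =>
    -- The final `1` gives the starting word positive rank, as the decay estimate for `π` requires.
    refine ⟨fun n => List.replicate n .two ++ [.one], ?_, ?_⟩
    · refine tendsto_atTop_mono (fun n => ?_) tendsto_id
      rw [rank_replicate_two_append, id]; omega
    · have h := tendsto_pi_pad_replicate_two (v := [.one]) (by simp [rank, Letter.val])
      simpa only [Converges, ofWord, weight, one_mul] using h
  | pair β w h1 h2 h3 =>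
    choose y hy1 hy2 hy3 hy4 using exists_approximating_word h3 (mul_pos h1 h3.pi_pos)
      (mul_le_of_le_one_left h3.pi_pos.le h2)
    refine ⟨y, tendsto_atTop_mono hy1 tendsto_id, fun i => ?_, ?_⟩
    · filter_upwards [eventually_gt_atTop i] with n hn
      exact hy2 n i hn
    · simp only [ofWord, weight, one_mul]
      have h4 := tendsto_one_div_add_atTop_nhds_zero_nat (𝕜 := ℝ)
      refine tendsto_of_tendsto_of_tendsto_of_le_of_le ?_ ?_ hy3 hy4
      · simpa using (h4.const_sub 1).const_mul (β * w.pi)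
      · simpa using h4.const_add (β * w.pi)

end Omega

/-! ### The Martin boundary -/

theorem tendsto_phi_ofWord_iff {y : ℕ → Word} (hy : Tendsto (fun n => rank (y n)) atTop atTop)
    (φ : Word → ℝ) : Tendsto (fun n => (Omega.ofWord (y n)).phi) atTop (𝓝 φ) ↔
      Tendsto (fun n v => martinKernel v (y n)) atTop (𝓝 φ) := by
  rw [tendsto_pi_nhds, tendsto_pi_nhds]
  refine forall_congr' fun v => tendsto_congr' ?_
  filter_upwards [hy.eventually_ge_atTop (rank v)] with n hn
  exact Omega.phi_ofWord hn

theorem martinKernel_nonneg (v w : Word) : 0 ≤ martinKernel v w := by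
  rw [martinKernel]; positivity

/-- At `w` itself the kernel is nonzero, but it vanishes at all successors of `w`. -/
theorem not_isHarmonic_martinKernel (w : Word) : ¬ IsHarmonic fun v => martinKernel v w := by
  intro h
  have h1 : martinKernel w w = ∑ x ∈ successors w, martinKernel x w := h w
  rw [Finset.sum_eq_zero] at h1
  · have h2 : dim w w = 1 := by rw [dim_eq_numPaths (k := 0) rfl]; simp [numPaths]
    rw [martinKernel, h2] at h1
    exact div_ne_zero (by norm_num) (Word.dim_nil_ne_zero w) h1
  · intro x hx
    have := ((mem_successors _ _).1 hx).rank_eq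
    rw [martinKernel, dim_eq_zero (by omega)]; simp

namespace Omega

theorem phi_mem_martinBoundary (ω : Omega) : ω.phi ∈ martinBoundary := by
  obtain ⟨y, hy, hlim⟩ := exists_converges_ofWord ω
  refine ⟨mem_closure_of_tendsto ((tendsto_phi_ofWord_iff hy _).1 hlim.phi)
    (Eventually.of_forall fun n => ⟨y n, rfl⟩), ?_⟩
  rintro ⟨w, hw⟩
  have hw' : (fun v => martinKernel v w) = ω.phi := hw
  exact not_isHarmonic_martinKernel w (hw' ▸ ω.isHarmonic_phi)

/-- Individual `p` values can be negative; nonnegativity is inherited from the approximating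
kernels. -/
theorem phi_nonneg (ω : Omega) (v : Word) : 0 ≤ ω.phi v := by
  obtain ⟨y, hy, hlim⟩ := exists_converges_ofWord ω
  exact ge_of_tendsto' (tendsto_pi_nhds.1 ((tendsto_phi_ofWord_iff hy _).1 hlim.phi) v)
    fun n => martinKernel_nonneg v (y n)

theorem exists_phi_eq {φ : Word → ℝ} (h : φ ∈ martinBoundary) : ∃ ω : Omega, ω.phi = φ := by
  obtain ⟨f, hf, hlim⟩ := mem_closure_iff_seq_limit.1 h.1
  choose y hy using hf
  have hlim' : Tendsto (fun n v => martinKernel v (y n)) atTop (𝓝 φ) :=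
    hlim.congr fun n => (hy n).symm
  -- Kernels of rank below `N` form a finite, hence closed, set missing `φ`, so the sequence
  -- eventually leaves it.
  have hrank : Tendsto (fun n => rank (y n)) atTop atTop := by
    refine tendsto_atTop.2 fun N => ?_
    have hfin : (((fun w : Word => fun v : Word => martinKernel v w) ''
        ((Finset.range N).biUnion level : Finset Word)) : Set (Word → ℝ)).Finite :=
      (Finset.finite_toSet _).image _
    have hφ : φ ∈ (((fun w : Word => fun v : Word => martinKernel v w) ''
        ((Finset.range N).biUnion level : Finset Word)) : Set (Word → ℝ))ᶜ := by
      rintro ⟨w, -, hw⟩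
      exact h.2 ⟨w, hw⟩
    filter_upwards [hlim'.eventually (hfin.isClosed.isOpen_compl.mem_nhds hφ)] with n hn
    by_contra hlt
    refine hn ⟨y n, ?_, rfl⟩
    simp only [Finset.coe_biUnion, Set.mem_iUnion, Finset.mem_coe, Finset.mem_range, mem_level,
      exists_prop, exists_eq_right']
    omega
  obtain ⟨ω, ψ, hψ, hω⟩ := exists_converges_subseq fun n => ofWord (y n)
  exact ⟨ω, tendsto_nhds_unique hω.phi
    (((tendsto_phi_ofWord_iff hrank φ).2 hlim').comp hψ.tendsto_atTop)⟩

/-- The map `ω ↦ φ_ω` onto the Martin boundary. -/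
noncomputable def equivMartinBoundary : Omega ≃ martinBoundary :=
  Equiv.ofBijective (fun ω => ⟨ω.phi, ω.phi_mem_martinBoundary⟩)
    ⟨fun _ _ h => phi_injective (congrArg Subtype.val h),
      fun φ => (exists_phi_eq φ.2).imp fun _ h => Subtype.ext h⟩

/-- Every subsequence has a convergent further subsequence, whose limit is forced by continuity and
injectivity of `phi`. -/
theorem converges_of_tendsto_phi {x : ℕ → Omega} {ω : Omega}
    (h : Tendsto (fun n => (x n).phi) atTop (𝓝 ω.phi)) : Tendsto x atTop (𝓝 ω) := by
  refine tendsto_of_subseq_tendsto fun ns hns => ?_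
  obtain ⟨ω', ψ, hψ, hω'⟩ := exists_converges_subseq (x ∘ ns)
  have h1 := tendsto_nhds_unique hω'.phi (h.comp (hns.comp hψ.tendsto_atTop))
  obtain rfl := phi_injective h1
  exact ⟨ψ, (tendsto_iff_converges _ _).2 hω'⟩

/-- The homeomorphism of `Ω` onto the Martin boundary. -/
noncomputable def homeoMartinBoundary : Omega ≃ₜ martinBoundary where
  toEquiv := equivMartinBoundary
  continuous_toFun := continuous_phi.subtype_mk _
  continuous_invFun := by
    refine continuous_iff_seqContinuous.2 fun φ φ₀ h => ?_
    refine converges_of_tendsto_phi ?_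
    have hval : ∀ φ : martinBoundary, (equivMartinBoundary.symm φ).phi = φ := fun φ =>
      congrArg Subtype.val (equivMartinBoundary.apply_symm_apply φ)
    simp only [Equiv.invFun_as_coe, Function.comp_apply, hval]
    exact (continuous_subtype_val.tendsto φ₀).comp h

instance : T2Space Omega := homeoMartinBoundary.isEmbedding.t2Space

instance : CompactSpace Omega := by
  -- Sequential compactness is moved to the boundary, a subspace of a countable product of lines,
  -- where it implies compactness.
  have h : IsSeqCompact (Set.univ : Set martinBoundary) := by
    intro φ _
    obtain ⟨ω, ψ, hψ, hω⟩ := exists_converges_subseq fun n => homeoMartinBoundary.symm (φ n)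
    refine ⟨homeoMartinBoundary ω, Set.mem_univ _, ψ, hψ, ?_⟩
    have := (homeoMartinBoundary.continuous.tendsto ω).comp ((tendsto_iff_converges _ _).2 hω)
    simpa [Function.comp_def] using this
  have : CompactSpace martinBoundary := ⟨h.isCompact⟩
  exact homeoMartinBoundary.symm.compactSpace

end Omega

/-! ### Integral representations -/

/-- Evaluation at `v` as a continuous function on `Ω`. -/
noncomputable def evalPhi (v : Word) : BoundedContinuousFunction Omega ℝ :=
  BoundedContinuousFunction.mkOfCompact
    ⟨fun ω => ω.phi v, (continuous_apply v).comp Omega.continuous_phi⟩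

theorem integrable_phi (M : Measure Omega) [IsProbabilityMeasure M] (v : Word) :
    Integrable (fun ω : Omega => ω.phi v) M := (evalPhi v).integrable M

theorem integral_phi_mem_normalizedHarmonic (M : Measure Omega) [IsProbabilityMeasure M] :
    (fun v => ∫ ω : Omega, ω.phi v ∂M) ∈ normalizedHarmonic := by
  refine ⟨fun u => ?_, fun v => integral_nonneg fun ω => ω.phi_nonneg v, ?_⟩
  · rw [← integral_finsetSum _ fun v _ => integrable_phi M v]
    exact integral_congr_ae (Eventually.of_forall fun ω => ω.isHarmonic_phi u)
  · simp [Omega.phi_nil]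

/-- In the level-`n` expansion, `d(v, w) φ(w)` is rewritten as `d(∅, w) φ(w) · K(v, w)`. At `v = ∅`
the weights sum to `φ(∅)`. -/
theorem IsHarmonic.eq_sum_martinKernel {φ : Word → ℝ} (h : IsHarmonic φ) {n : ℕ} {v : Word}
    (hv : rank v ≤ n) :
    φ v = ∑ w ∈ level n, ((dim [] w : ℝ) * φ w) * (Omega.ofWord w).phi v := by
  obtain ⟨k, rfl⟩ := Nat.exists_eq_add_of_le hv
  rw [h.eq_sum_numPaths k v]
  refine Finset.sum_congr rfl fun w hw => ?_
  have hw' := (mem_level _ _).1 hw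
  have hne := Word.dim_nil_ne_zero w
  rw [Omega.phi_ofWord (by omega), martinKernel, dim_eq_numPaths hw']
  field_simp

/-- The distribution on `Ω` of the points `(1, ⋯ 1 1 w)`, where `w` is the random word of rank
`n` given by a harmonic function. -/
noncomputable def levelMeasure (φ : Word → ℝ) (n : ℕ) : Measure Omega :=
  ∑ w ∈ level n, ENNReal.ofReal ((dim [] w : ℝ) * φ w) • Measure.dirac (Omega.ofWord w)

theorem isProbabilityMeasure_levelMeasure {φ : Word → ℝ} (h : φ ∈ normalizedHarmonic) (n : ℕ) :
    IsProbabilityMeasure (levelMeasure φ n) := by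
  constructor
  have h1 := h.1.eq_sum_martinKernel (n := n) (v := []) (by simp [rank])
  simp only [Omega.phi_nil, mul_one, h.2.2] at h1
  simp only [levelMeasure, Measure.finsetSum_apply, Measure.smul_apply, measure_univ, smul_eq_mul,
    mul_one]
  rw [← ENNReal.ofReal_sum_of_nonneg fun w _ => mul_nonneg (Nat.cast_nonneg _) (h.2.1 w), ← h1,
    ENNReal.ofReal_one]

theorem integral_levelMeasure {φ : Word → ℝ} (h : φ ∈ normalizedHarmonic) {n : ℕ} {v : Word}
    (hv : rank v ≤ n) : ∫ ω : Omega, ω.phi v ∂(levelMeasure φ n) = φ v := by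
  rw [levelMeasure, integral_finsetSum_measure, h.1.eq_sum_martinKernel hv]
  · refine Finset.sum_congr rfl fun w _ => ?_
    rw [integral_smul_measure, integral_dirac,
      ENNReal.toReal_ofReal (mul_nonneg (Nat.cast_nonneg _) (h.2.1 w)), smul_eq_mul]
  · intro w _
    exact (integrable_phi _ v).smul_measure ENNReal.ofReal_ne_top

theorem exists_representing_measure {φ : Word → ℝ} (h : φ ∈ normalizedHarmonic) :
    ∃ M : Measure Omega, IsProbabilityMeasure M ∧ ∀ v, φ v = ∫ ω : Omega, ω.phi v ∂M := by
  let μ : ℕ → ProbabilityMeasure Omega := fun n =>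
    ⟨levelMeasure φ n, isProbabilityMeasure_levelMeasure h n⟩
  -- Probability measures on compact `Ω` form a weakly compact space; a nonprincipal ultrafilter
  -- yields a limit without extracting a subsequence, and the integrals of `phi` at `v` are constant
  -- once `n ≥ rank v`.
  obtain ⟨M, -, hM⟩ := isCompact_univ.ultrafilter_le_nhds
    ((Filter.hyperfilter ℕ : Ultrafilter ℕ).map μ) (by simp)
  refine ⟨M, inferInstance, fun v => ?_⟩
  have hM' : Tendsto μ (Filter.hyperfilter ℕ : Filter ℕ) (𝓝 M) := hM
  have h1 := ProbabilityMeasure.tendsto_iff_forall_integral_tendsto.1 hM' (evalPhi v)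
  refine tendsto_nhds_unique (tendsto_const_nhds.congr' ?_) h1
  have h2 : ∀ᶠ n in (Filter.hyperfilter ℕ : Filter ℕ), rank v ≤ n :=
    (Nat.hyperfilter_le_atTop) (eventually_ge_atTop (rank v))
  filter_upwards [h2] with n hn
  exact (integral_levelMeasure h hn).symm

end YoungFibonacci

theorem theorem3p2 :
    (∃ e : YoungFibonacci.Omega ≃ₜ YoungFibonacci.martinBoundary,
      ∀ ω : YoungFibonacci.Omega,
        (e ω : YoungFibonacci.Word → ℝ) = YoungFibonacci.Omega.phi ω) ∧
    (∀ M : MeasureTheory.Measure YoungFibonacci.Omega,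
      MeasureTheory.IsProbabilityMeasure M →
        (∀ v : YoungFibonacci.Word,
          MeasureTheory.Integrable (fun ω => YoungFibonacci.Omega.phi ω v) M) ∧
        (fun v : YoungFibonacci.Word => ∫ ω, YoungFibonacci.Omega.phi ω v ∂M) ∈
          YoungFibonacci.normalizedHarmonic) ∧
    (∀ φ ∈ YoungFibonacci.normalizedHarmonic,
      ∃ M : MeasureTheory.Measure YoungFibonacci.Omega,
        MeasureTheory.IsProbabilityMeasure M ∧
        ∀ v : YoungFibonacci.Word, φ v = ∫ ω, YoungFibonacci.Omega.phi ω v ∂M) :=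
  ⟨⟨YoungFibonacci.Omega.homeoMartinBoundary, fun _ => rfl⟩,
    fun M _ => ⟨YoungFibonacci.integrable_phi M,
      YoungFibonacci.integral_phi_mem_normalizedHarmonic M⟩,
    fun _ h => YoungFibonacci.exists_representing_measure h⟩
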